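/- **Setting.** Let $d\ge 1$ and $\lambda>0$. A probability measure on $\mathbb R^d$ is *elliptic*, written $\mu\sim E(m,\Sigma,g)$, if $m\in\mathbb R^d$, $\Sigma\in\mathbb R^{d\times d}$ is symmetric positive definite, and $\mu$ has Lebesgue density $p_{m,\Sigma,g}(x)=\det(\Sigma)^{-1/2}g\big((x-m)^{T}\Sigma^{-1}(x-m)\big)$, where $g\colon[0,\infty)\to(0,\infty)$ is smooth and integrable with $\frac{\pi^{d/2}}{\Gamma(d/2)}\int_0^\infty r^{d/2-1}g(r)\,dr=1$, $\int_0^\infty r^{(d-1)/2}g(r)\,dr<\infty$ and $\int_0^\infty r^{d/2}g(r)\,dr<\infty$. Put $\kappa_g:=\frac1d\int_{\mathbb R^d}\|y\|^2g(\|y\|^2)\,dy$. For a smooth positive probability density $\rho$ on $\mathbb R^d$ with finite second moment let $C(\rho)$ be its covariance matrix. A *Kalman–Wasserstein dual geodesic with potential* $f\in C^\infty(\mathbb R^d)$ is a smooth curve $(\rho_t)_{t\in[0,1]}$ of such densities ($(t,x)\mapsto\rho_t(x)$ smooth, $t\mapsto C(\rho_t)$ continuous) with $$\partial_t\rho_t=-\nabla\cdot\big(\rho_t\,(C(\rho_t)+\lambda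 I)\nabla f\big).$$ The Kalman–Wasserstein divergence of two probability measures on $\mathbb R^d$ is $$D^{KW}(\mu\mid\nu):=\inf\int_0^1 t\int_{\mathbb R^d}\big\langle\nabla f,(C(\rho_t)+\lambda I)\nabla f\big\rangle\rho_t\,dx\,dt\in[0,\infty],$$ where the infimum is over all such geodesics with a quadratic potential $f(x)=\frac12x^{T}Bx+b^{T}x+c$ ($B$ symmetric) for which $\rho_0$ and $\rho_1$ are the densities of $\mu$ and $\nu$. **Theorem (KWKL divergence).** Let $\mu\sim E(m_0,\Sigma_0,g)$ and $\nu\sim E(m_1,\Sigma_1,g)$, where $\Sigma_0$ and $\Sigma_1$ are simultaneously diagonalizable. Set $\Delta m:=m_1-m_0$, $\Delta\Sigma:=\Sigma_1-\Sigma_0$, $P:=\Delta\Sigma(\Delta\Sigma)^{\dagger}$, $\Delta\Sigma^{\perp}:=I-P$ and $\Sigma_{\ell,\lambda}:=\kappa_g\Sigma_\ell+\lambda I$ for $\ell\in\{0,1\}$, where $\dagger$ is the Moore–Penrose inverse, and $$\Xi:=\Sigma_1\ln\big(\Sigma_1\Sigma_0^{-1}\big)+\frac1{\kappa_g}\Sigma_{1,\lambda}\ln\big(\Sigma_{0,\lambda}\Sigma_{1,\lambda}^{-1}\big).$$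 Then, for every $\lambda>0$, $D^{KW}(\mu\mid\nu)$ is finite and $$D^{KW}(\mu\mid\nu)=\frac{\kappa_g}{4\lambda}\operatorname{tr}(\Xi)+\frac12\,\Delta m^{T}\Big(\Delta\Sigma^{\perp}\Sigma_{0,\lambda}^{-1}\Delta\Sigma^{\perp}+\frac1{2\lambda}P\,\Xi\,P\,\big((\sqrt{\Sigma_1}-\sqrt{\Sigma_0})^{\dagger}\big)^{2}\Big)\Delta m .$$ -/

import Mathlib

open MeasureTheory Set
open scoped Matrix ENNReal ContDiff

noncomputable section

namespace KW

/-- `ℝᵈ` with its Euclidean structure and Lebesgue measure. -/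
abbrev E (d : ℕ) : Type := EuclideanSpace ℝ (Fin d)

/-- A matrix acting on a vector of `ℝᵈ`. -/
def act {d : ℕ} (A : Matrix (Fin d) (Fin d) ℝ) (x : E d) : E d :=
  WithLp.toLp 2 (A *ᵥ x.ofLp)

/-- The quadratic form `xᵀ A x`. -/
def quadForm {d : ℕ} (A : Matrix (Fin d) (Fin d) ℝ) (x : E d) : ℝ :=
  x.ofLp ⬝ᵥ (A *ᵥ x.ofLp)

/-! ### Elliptic distributions -/

/-- Admissible density generators `g : [0,∞) → (0,∞)` in dimension `d`: smooth, positive and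
integrable, normalized, with finite expectation and finite variance.
Only the values of `g` on `[0,∞)` matter. -/
structure IsGenerator (d : ℕ) (g : ℝ → ℝ) : Prop where
  smooth : ContDiffOn ℝ ∞ g (Ici 0)
  pos : ∀ r, 0 ≤ r → 0 < g r
  integrable : IntegrableOn g (Ioi 0)
  normalized : Real.pi ^ ((d : ℝ) / 2) / Real.Gamma ((d : ℝ) / 2) *
    ∫ r in Ioi (0 : ℝ), r ^ ((d : ℝ) / 2 - 1) * g r = 1
  finite_expectation : IntegrableOn (fun r : ℝ => r ^ (((d : ℝ) - 1) / 2) * g r) (Ioi 0)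
  finite_variance : IntegrableOn (fun r : ℝ => r ^ ((d : ℝ) / 2) * g r) (Ioi 0)

/-- The density `det(Σ)^(-1/2) g((x - m)ᵀ Σ⁻¹ (x - m))`. -/
def ellipticDensity {d : ℕ} (m : E d) (S : Matrix (Fin d) (Fin d) ℝ) (g : ℝ → ℝ) (x : E d) : ℝ :=
  S.det ^ (-(1 / 2) : ℝ) * g (quadForm S⁻¹ (x - m))

/-- The measure with Lebesgue density `ρ`. -/
def ofDensity {d : ℕ} (ρ : E d → ℝ) : Measure (E d) :=
  volume.withDensity fun x => ENNReal.ofReal (ρ x)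

/-- `μ ∼ E(m, Σ, g)`. -/
structure IsElliptic {d : ℕ} (m : E d) (S : Matrix (Fin d) (Fin d) ℝ) (g : ℝ → ℝ)
    (μ : Measure (E d)) : Prop where
  posDef : S.PosDef
  generator : IsGenerator d g
  density : μ = ofDensity (ellipticDensity m S g)

/-- `κ_g = (1/d) ∫ ‖y‖² g(‖y‖²) dy`. -/
def kappa (d : ℕ) (g : ℝ → ℝ) : ℝ :=
  1 / (d : ℝ) * ∫ y : E d, ‖y‖ ^ 2 * g (‖y‖ ^ 2)

/-! ### The Kalman–Wasserstein geometry -/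

/-- Smooth positive probability densities on `ℝᵈ` with finite second moment, so that the
covariance is defined. -/
structure IsSmoothPosDensity {d : ℕ} (ρ : E d → ℝ) : Prop where
  smooth : ContDiff ℝ ∞ ρ
  pos : ∀ x, 0 < ρ x
  integral_eq_one : ∫ x, ρ x = 1
  second_moment : Integrable fun x => ‖x‖ ^ 2 * ρ x

/-- The mean of a density, coordinatewise. -/
def mean {d : ℕ} (ρ : E d → ℝ) (i : Fin d) : ℝ := ∫ x : E d, x i * ρ x

/-- The covariance matrix `C(ρ)` of a density. -/
def cov {d : ℕ} (ρ : E d → ℝ) : Matrix (Fin d) (Fin d) ℝ :=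
  Matrix.of fun i j => ∫ x : E d, (x i - mean ρ i) * (x j - mean ρ j) * ρ x

/-- The divergence `∇ · v` of a vector field on `ℝᵈ`. -/
def divergence {d : ℕ} (v : E d → E d) (x : E d) : ℝ :=
  ∑ i, fderiv ℝ (fun y => v y i) x (EuclideanSpace.single i 1)

/-- The velocity field `(C(ρ) + λ I) ∇f`. -/
def velocity {d : ℕ} (lam : ℝ) (ρ f : E d → ℝ) (x : E d) : E d :=
  act (cov ρ + lam • (1 : Matrix (Fin d) (Fin d) ℝ)) (gradient f x)

/-- The Kalman–Wasserstein inertia operator `[f] ↦ -∇ · (ρ (C(ρ) + λ I) ∇f)`. -/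
def inertia {d : ℕ} (lam : ℝ) (ρ f : E d → ℝ) (x : E d) : ℝ :=
  -divergence (fun y => ρ y • velocity lam ρ f y) x

/-- The squared norm `∫ ⟨∇f, ρ (C(ρ) + λ I) ∇f⟩ dx` of the covector `[f]`, which is also that of
the tangent vector `inertia lam ρ f`. For `0 ≤ λ` the integrand is nonnegative. -/
def metricSq {d : ℕ} (lam : ℝ) (ρ f : E d → ℝ) : ℝ≥0∞ :=
  ∫⁻ x, ENNReal.ofReal (inner ℝ (gradient f x) (ρ x • velocity lam ρ f x))

/-- `ρ : [0,1] → P₊^∞(ℝᵈ)` is a smooth curve and it is the dual geodesic of the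
Kalman–Wasserstein geometry with potential `f`, that is, `∂ₜ ρ_t = φ_{ρ_t}([f])`. -/
structure IsDualGeodesic {d : ℕ} (lam : ℝ) (f : E d → ℝ) (ρ : ℝ → E d → ℝ) : Prop where
  potential_smooth : ContDiff ℝ ∞ f
  density : ∀ t ∈ Icc (0 : ℝ) 1, IsSmoothPosDensity (ρ t)
  smooth : ContDiffOn ℝ ∞ (fun p : ℝ × E d => ρ p.1 p.2) (Icc (0 : ℝ) 1 ×ˢ univ)
  cov_continuous : ContinuousOn (fun t => cov (ρ t)) (Icc (0 : ℝ) 1)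
  geodesic : ∀ t ∈ Icc (0 : ℝ) 1, ∀ x : E d,
    HasDerivWithinAt (fun s => ρ s x) (inertia lam (ρ t) f x) (Icc (0 : ℝ) 1) t

/-- Quadratic potentials `f(x) = ½ xᵀ B x + bᵀ x + c` with `B` symmetric. -/
def IsQuadratic {d : ℕ} (f : E d → ℝ) : Prop :=
  ∃ (B : Matrix (Fin d) (Fin d) ℝ) (b : E d) (c : ℝ), B.IsSymm ∧
    ∀ x, f x = 1 / 2 * quadForm B x + inner ℝ b x + c

/-- `∫₀¹ t g_{γ(t)}(γ'(t), γ'(t)) dt` along the dual geodesic with potential `f`. -/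
def action {d : ℕ} (lam : ℝ) (f : E d → ℝ) (ρ : ℝ → E d → ℝ) : ℝ≥0∞ :=
  ∫⁻ t in Icc (0 : ℝ) 1, ENNReal.ofReal t * metricSq lam (ρ t) f

/-- The Kalman–Wasserstein divergence `D^KW(μ | ν)` on the noncompact space `ℝᵈ`: the infimum of
the action over the Kalman–Wasserstein dual geodesics from `μ` to `ν` that have a quadratic
potential (`∞` if there is none). -/
def divKW {d : ℕ} (lam : ℝ) (μ ν : Measure (E d)) : ℝ≥0∞ :=
  ⨅ (f : E d → ℝ) (ρ : ℝ → E d → ℝ) (_ : IsQuadratic f) (_ : IsDualGeodesic lam f ρ)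
    (_ : ofDensity (ρ 0) = μ) (_ : ofDensity (ρ 1) = ν), action lam f ρ

/-! ### Matrix functions -/

/-- `A` and `B` are diagonal in a common basis. -/
def SimDiag {d : ℕ} (A B : Matrix (Fin d) (Fin d) ℝ) : Prop :=
  ∃ (Q : Matrix (Fin d) (Fin d) ℝ) (a b : Fin d → ℝ), IsUnit Q.det ∧
    A = Q * Matrix.diagonal a * Q⁻¹ ∧ B = Q * Matrix.diagonal b * Q⁻¹

/-- The logarithm of a symmetric positive definite matrix. -/
def mlog {d : ℕ} (A : Matrix (Fin d) (Fin d) ℝ) : Matrix (Fin d) (Fin d) ℝ :=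
  cfc Real.log A

/-- The square root of a symmetric positive semidefinite matrix. -/
def msqrt {d : ℕ} (A : Matrix (Fin d) (Fin d) ℝ) : Matrix (Fin d) (Fin d) ℝ :=
  cfc Real.sqrt A

/-- The Moore–Penrose inverse `A†` of a symmetric matrix: nonzero eigenvalues are inverted, and
the eigenvalue `0` is kept, since `0⁻¹ = 0`. -/
def pinv {d : ℕ} (A : Matrix (Fin d) (Fin d) ℝ) : Matrix (Fin d) (Fin d) ℝ :=
  cfc (fun x : ℝ => x⁻¹) A

/-- `Σ_λ = κ Σ + λ I`. -/
def inflate {d : ℕ} (κ lam : ℝ) (S : Matrix (Fin d) (Fin d) ℝ) : Matrix (Fin d) (Fin d) ℝ :=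
  κ • S + lam • (1 : Matrix (Fin d) (Fin d) ℝ)

/-- `Ξ = Σ₁ ln(Σ₁ Σ₀⁻¹) + κ⁻¹ Σ_{1,λ} ln(Σ_{0,λ} Σ_{1,λ}⁻¹)`. -/
def Xi {d : ℕ} (κ lam : ℝ) (S₀ S₁ : Matrix (Fin d) (Fin d) ℝ) : Matrix (Fin d) (Fin d) ℝ :=
  S₁ * mlog (S₁ * S₀⁻¹) +
    (1 / κ) • (inflate κ lam S₁ * mlog (inflate κ lam S₀ * (inflate κ lam S₁)⁻¹))

/-- `P = ΔΣ (ΔΣ)†`, the orthogonal projection onto the range of `ΔΣ = Σ₁ - Σ₀`. -/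
def proj {d : ℕ} (S₀ S₁ : Matrix (Fin d) (Fin d) ℝ) : Matrix (Fin d) (Fin d) ℝ :=
  (S₁ - S₀) * pinv (S₁ - S₀)

/-- `ΔΣ^⊥ = I - ΔΣ (ΔΣ)†`. -/
def projPerp {d : ℕ} (S₀ S₁ : Matrix (Fin d) (Fin d) ℝ) : Matrix (Fin d) (Fin d) ℝ :=
  1 - proj S₀ S₁

end KW

end

/-! A quadratic potential has the affine gradient Bx + b, so the velocity (C(ρ_t) + λI)∇f is affine
in x and ρ_t is carried by an affine flow x ↦ A(t)x + a(t) (`IsDualGeodesic.exists_flow`). Mean and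
covariance then obey closed ordinary differential equations, and the action, an integral of
expectations of quadratic functions, depends on them alone. The generator g enters only through the
covariance κ_g Σ of E(m, Σ, g).

The covariance solves the Riccati equation C' = (C + λ)BC + CB(C + λ). With Z = I + λC⁻¹ it becomes
linear, Z' = -λ(BZ + ZB), so that e^{λB} Z(1) e^{λB} = Z(0). Both Z(0) and Z(1) are diagonal in the
common orthonormal eigenbasis of the end points, and uniqueness of positive square roots forces B to
be diagonal there too (`eq_odiag_of_exp_mul_exp`). Everything decouples
(`IsDualGeodesic.exists_scalar`) into scalar equations c' = 2β(c + λ)c and n' = (c + λ)(βn + b).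

In one coordinate log(c/(c + λ)) is affine in t, which expresses β through the end points, and tβ²(c
+ λ)c has the primitive tβc/2 - ¼ log(c + λ), which yields the Ξ term. If β ≠ 0, then (βn + b)/√c is
constant, so the share of the mean in the action is δ²/(√q - √p)² times that of the variance, where
p, q are the end variances and δ is the displacement of the mean. If β = 0, the variance is constant
and the mean moves uniformly. The two cases are the range of ΔΣ and its complement
(`IsScalarGeodesic.integral_action`).

Hence all competitors in the infimum have the same action (`IsDualGeodesic.action_eq`), and explicit
scalar solutions show that there is one (`exists_isScalarGeodesic`, `isDualGeodesic_of_scalar`).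
`closedForm_eq_sum` turns the sum over coordinates into the matrix formula. -/

noncomputable section

namespace KW

/-! ### Matrices that are diagonal in an orthonormal basis -/

section Odiag

variable {d : ℕ}

/-- The matrix `U diag(a) Uᵀ`. -/
def odiag (U : Matrix (Fin d) (Fin d) ℝ) (a : Fin d → ℝ) : Matrix (Fin d) (Fin d) ℝ :=
  U * Matrix.diagonal a * Uᵀ

/-- Stated for any pair of mutually inverse matrices, so that it serves both an arbitrary common
eigenbasis and an orthonormal one. -/
theorem aeval_conj_diagonal {Q R : Matrix (Fin d) (Fin d) ℝ} (hQR : Q * R = 1) (hRQ : R * Q = 1)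
    (t : Fin d → ℝ) (p : Polynomial ℝ) :
    Polynomial.aeval (Q * Matrix.diagonal t * R) p =
      Q * Matrix.diagonal (fun i => p.eval (t i)) * R := by
  induction p using Polynomial.induction_on with
  | C a =>
    have : Matrix.diagonal (fun _ : Fin d => a) = a • (1 : Matrix (Fin d) (Fin d) ℝ) := by
      rw [Matrix.smul_one_eq_diagonal]
    simp [this, hQR, Algebra.algebraMap_eq_smul_one]
  | add p q hp hq =>
    have : Matrix.diagonal (fun i => (p + q).eval (t i)) =
        Matrix.diagonal (fun i => p.eval (t i)) + Matrix.diagonal (fun i => q.eval (t i)) := by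
      simp [Matrix.diagonal_add]
    rw [map_add, hp, hq, this, Matrix.mul_add, Matrix.add_mul]
  | monomial n a h =>
    rw [pow_succ, ← mul_assoc, map_mul, h, Polynomial.aeval_X]
    have : Matrix.diagonal (fun i => (Polynomial.C a * Polynomial.X ^ n * Polynomial.X).eval (t i)) =
        Matrix.diagonal (fun i => (Polynomial.C a * Polynomial.X ^ n).eval (t i)) *
          Matrix.diagonal t := by
      simp [Matrix.diagonal_mul_diagonal]
    rw [this]
    calc _ = Q * Matrix.diagonal (fun i => (Polynomial.C a * Polynomial.X ^ n).eval (t i)) *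
          (R * Q) * Matrix.diagonal t * R := by simp only [mul_assoc]
      _ = _ := by rw [hRQ, mul_one]; simp only [mul_assoc]

theorem exists_polynomial_eval (t : Fin d → ℝ) (v : Fin d → ℝ)
    (h : ∀ i j, t i = t j → v i = v j) : ∃ p : Polynomial ℝ, ∀ i, p.eval (t i) = v i := by
  classical
  have hex : ∃ F : ℝ → ℝ, ∀ i, F (t i) = v i :=
    ⟨Function.extend t v 0, fun i => by
      have : Function.FactorsThrough v t := fun i j hij => h i j hij
      exact this.extend_apply 0 i⟩
  obtain ⟨F, hF⟩ := hex
  refine ⟨Lagrange.interpolate (Finset.univ.image t) id F, fun i => ?_⟩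
  rw [← hF i]
  exact Lagrange.eval_interpolate_at_node F (Function.injective_id.injOn)
    (Finset.mem_image_of_mem t (Finset.mem_univ i))

/-- Two distinct pairs (a i, b i) collide for at most one value of s, so finitely many values have
to be avoided. -/
theorem exists_separating (a b : Fin d → ℝ) :
    ∃ s : ℝ, ∀ i j, a i + s * b i = a j + s * b j → a i = a j ∧ b i = b j := by
  classical
  obtain ⟨s, hs⟩ := (Set.finite_range
    (fun q : Fin d × Fin d => -(a q.1 - a q.2) / (b q.1 - b q.2))).exists_notMem
  refine ⟨s, fun i j hij => ?_⟩
  by_cases hb : b i = b j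
  · exact ⟨by rw [hb] at hij; linarith, hb⟩
  · exfalso
    refine hs ⟨(i, j), ?_⟩
    have : b i - b j ≠ 0 := sub_ne_zero.mpr hb
    simp only
    field_simp
    linarith

theorem exists_eq_odiag {T : Matrix (Fin d) (Fin d) ℝ} (hT : T.IsHermitian) :
    ∃ (U : Matrix (Fin d) (Fin d) ℝ) (a : Fin d → ℝ), U * Uᵀ = 1 ∧ Uᵀ * U = 1 ∧ T = odiag U a := by
  have hspec := hT.spectral_theorem
  have h1 := Unitary.mul_star_self_of_mem hT.eigenvectorUnitary.2
  have h2 := Unitary.star_mul_self_of_mem hT.eigenvectorUnitary.2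
  rw [Matrix.star_eq_conjTranspose, Matrix.conjTranspose_eq_transpose_of_trivial] at h1 h2
  rw [Unitary.conjStarAlgAut_apply, Matrix.star_eq_conjTranspose,
    Matrix.conjTranspose_eq_transpose_of_trivial] at hspec
  exact ⟨hT.eigenvectorUnitary.1, hT.eigenvalues, h1, h2, hspec⟩

/-- Symmetric matrices that are diagonal in a common basis are so in an orthonormal one. -/
theorem SimDiag.exists_odiag {S₀ S₁ : Matrix (Fin d) (Fin d) ℝ} (h : SimDiag S₀ S₁)
    (h₀ : S₀.IsHermitian) (h₁ : S₁.IsHermitian) :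
    ∃ (U : Matrix (Fin d) (Fin d) ℝ) (a b : Fin d → ℝ), U * Uᵀ = 1 ∧ Uᵀ * U = 1 ∧
      S₀ = odiag U a ∧ S₁ = odiag U b := by
  obtain ⟨Q, a, b, hQ, rfl, rfl⟩ := h
  have hQR : Q * Q⁻¹ = 1 := Matrix.mul_nonsing_inv _ hQ
  have hRQ : Q⁻¹ * Q = 1 := Matrix.nonsing_inv_mul _ hQ
  -- For a separating s both matrices are polynomials in S₀ + s S₁. This matrix is symmetric, and an
  -- orthonormal eigenbasis of it diagonalizes all its polynomials.
  obtain ⟨s, hs⟩ := exists_separating a b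
  obtain ⟨p, hp⟩ := exists_polynomial_eval (fun i => a i + s * b i) a fun i j hij => (hs i j hij).1
  obtain ⟨q, hq⟩ := exists_polynomial_eval (fun i => a i + s * b i) b fun i j hij => (hs i j hij).2
  have hT : Q * Matrix.diagonal (fun i => a i + s * b i) * Q⁻¹ =
      Q * Matrix.diagonal a * Q⁻¹ + s • (Q * Matrix.diagonal b * Q⁻¹) := by
    have : Matrix.diagonal (fun i => a i + s * b i) =
        Matrix.diagonal a + s • Matrix.diagonal b := by
      rw [← Matrix.diagonal_smul, Matrix.diagonal_add]; rfl
    rw [this, Matrix.mul_add, Matrix.add_mul]; simp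
  have hTh : (Q * Matrix.diagonal (fun i => a i + s * b i) * Q⁻¹).IsHermitian := by
    rw [hT]
    refine h₀.add ?_
    rw [Matrix.IsHermitian, Matrix.conjTranspose_smul, h₁.eq]; simp
  obtain ⟨U, t, hUU, hUU', hTU⟩ := exists_eq_odiag hTh
  rw [odiag] at hTU
  refine ⟨U, fun i => p.eval (t i), fun i => q.eval (t i), hUU, hUU',
    ?_, ?_⟩
  · rw [odiag, ← aeval_conj_diagonal hUU hUU', ← hTU, aeval_conj_diagonal hQR hRQ]
    simp only [hp]
  · rw [odiag, ← aeval_conj_diagonal hUU hUU', ← hTU, aeval_conj_diagonal hQR hRQ]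
    simp only [hq]

variable {U : Matrix (Fin d) (Fin d) ℝ}

theorem odiag_mul (hU' : Uᵀ * U = 1) (a b : Fin d → ℝ) :
    odiag U a * odiag U b = odiag U (fun i => a i * b i) := by
  calc _ = U * Matrix.diagonal a * (Uᵀ * U) * Matrix.diagonal b * Uᵀ := by
        simp only [odiag, mul_assoc]
    _ = _ := by rw [hU', mul_one, odiag, ← Matrix.diagonal_mul_diagonal]; simp only [mul_assoc]

theorem odiag_add (a b : Fin d → ℝ) : odiag U a + odiag U b = odiag U (fun i => a i + b i) := by
  rw [odiag, odiag, odiag, ← Matrix.diagonal_add, Matrix.mul_add, Matrix.add_mul]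

theorem odiag_sub (a b : Fin d → ℝ) : odiag U a - odiag U b = odiag U (fun i => a i - b i) := by
  rw [odiag, odiag, odiag, ← Matrix.diagonal_sub, Matrix.mul_sub, Matrix.sub_mul]

theorem smul_odiag (r : ℝ) (a : Fin d → ℝ) : r • odiag U a = odiag U (fun i => r * a i) := by
  have : Matrix.diagonal (fun i => r * a i) = r • Matrix.diagonal a := by
    rw [← Matrix.diagonal_smul]; rfl
  rw [odiag, odiag, this]; simp

theorem odiag_one (hU : U * Uᵀ = 1) : odiag U (fun _ => 1) = 1 := by
  have : Matrix.diagonal (fun _ : Fin d => (1 : ℝ)) = 1 := Matrix.diagonal_one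
  rw [odiag, this, mul_one, hU]

theorem odiag_injective (hU' : Uᵀ * U = 1) : Function.Injective (odiag U) := by
  intro a b h
  have h2 : Uᵀ * odiag U a * U = Uᵀ * odiag U b * U := by rw [h]
  have key : ∀ c, Uᵀ * odiag U c * U = Matrix.diagonal c := fun c => by
    calc _ = (Uᵀ * U) * Matrix.diagonal c * (Uᵀ * U) := by simp only [odiag, mul_assoc]
      _ = _ := by rw [hU', one_mul, mul_one]
  rw [key, key] at h2
  exact Matrix.diagonal_injective h2

theorem odiag_inv (hU : U * Uᵀ = 1) (hU' : Uᵀ * U = 1) {a : Fin d → ℝ} (ha : ∀ i, a i ≠ 0) :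
    (odiag U a)⁻¹ = odiag U (fun i => (a i)⁻¹) := by
  apply Matrix.inv_eq_right_inv
  rw [odiag_mul hU', ← odiag_one hU]
  congr 1; ext i; exact mul_inv_cancel₀ (ha i)

theorem odiag_transpose (a : Fin d → ℝ) : (odiag U a)ᵀ = odiag U a := by
  simp [odiag, mul_assoc]

theorem odiag_isSelfAdjoint (a : Fin d → ℝ) : IsSelfAdjoint (odiag U a) := by
  rw [IsSelfAdjoint, Matrix.star_eq_conjTranspose, Matrix.conjTranspose_eq_transpose_of_trivial,
    odiag_transpose]

theorem odiag_trace (hU' : Uᵀ * U = 1) (a : Fin d → ℝ) : (odiag U a).trace = ∑ i, a i := by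
  rw [odiag, Matrix.trace_mul_comm, ← mul_assoc, hU', one_mul, Matrix.trace_diagonal]

theorem odiag_det (hU : U * Uᵀ = 1) (a : Fin d → ℝ) : (odiag U a).det = ∏ i, a i := by
  have : U.det * Uᵀ.det = 1 := by rw [← Matrix.det_mul, hU, Matrix.det_one]
  rw [odiag, Matrix.det_mul, Matrix.det_mul, mul_right_comm, this, one_mul, Matrix.det_diagonal]

theorem odiag_pow (hU : U * Uᵀ = 1) (hU' : Uᵀ * U = 1) (a : Fin d → ℝ) (n : ℕ) :
    odiag U a ^ n = odiag U (fun i => a i ^ n) := by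
  induction n with
  | zero => simp [odiag_one hU]
  | succ n ih => rw [pow_succ, ih, odiag_mul hU']; simp [pow_succ]

theorem spectrum_odiag (hU : U * Uᵀ = 1) (hU' : Uᵀ * U = 1) (a : Fin d → ℝ) :
    spectrum ℝ (odiag U a) ⊆ range a := by
  intro x hx
  by_contra hxa
  refine hx ?_
  have hne : ∀ i, x - a i ≠ 0 := fun i h => hxa ⟨i, by linarith⟩
  have : algebraMap ℝ (Matrix (Fin d) (Fin d) ℝ) x - odiag U a = odiag U (fun i => x - a i) := by
    rw [Algebra.algebraMap_eq_smul_one, ← odiag_one hU, smul_odiag, odiag_sub]; simp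
  rw [spectrum.mem_resolventSet_iff, this]
  refine IsUnit.of_mul_eq_one (odiag U (fun i => (x - a i)⁻¹)) ?_
  rw [odiag_mul hU', ← odiag_one hU]
  congr 1; ext i; exact mul_inv_cancel₀ (hne i)

/-- On the finite spectrum every function agrees with an interpolating polynomial, and polynomials
act entrywise on the diagonal. -/
theorem cfc_odiag (hU : U * Uᵀ = 1) (hU' : Uᵀ * U = 1) (f : ℝ → ℝ) (a : Fin d → ℝ) :
    cfc f (odiag U a) = odiag U (fun i => f (a i)) := by
  obtain ⟨p, hp⟩ := exists_polynomial_eval a (fun i => f (a i)) fun i j h => by rw [h]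
  have h1 : cfc f (odiag U a) = cfc p.eval (odiag U a) := by
    refine cfc_congr fun x hx => ?_
    obtain ⟨i, rfl⟩ := spectrum_odiag hU hU' a hx
    exact (hp i).symm
  rw [h1, cfc_polynomial p _ (odiag_isSelfAdjoint a), odiag, aeval_conj_diagonal hU hU']
  simp only [hp]; rfl

theorem odiag_mulVec (a : Fin d → ℝ) (x : Fin d → ℝ) :
    odiag U a *ᵥ x = U *ᵥ (fun i => a i * (Uᵀ *ᵥ x) i) := by
  rw [odiag, ← Matrix.mulVec_mulVec, ← Matrix.mulVec_mulVec]
  congr 1; ext i; simp [Matrix.mulVec_diagonal]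

theorem quadForm_odiag (a : Fin d → ℝ) (x : E d) :
    quadForm (odiag U a) x = ∑ i, a i * (Uᵀ *ᵥ x.ofLp) i ^ 2 := by
  rw [quadForm, odiag_mulVec, Matrix.dotProduct_mulVec, ← Matrix.mulVec_transpose, dotProduct]
  refine Finset.sum_congr rfl fun i _ => by ring

theorem odiag_pos_of_posDef (hU' : Uᵀ * U = 1) {a : Fin d → ℝ} (h : (odiag U a).PosDef) (i : Fin d) :
    0 < a i := by
  have hv : U *ᵥ Pi.single i 1 ≠ 0 := fun h0 => by
    have : Uᵀ *ᵥ (U *ᵥ Pi.single i 1) = 0 := by rw [h0, Matrix.mulVec_zero]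
    rw [Matrix.mulVec_mulVec, hU', Matrix.one_mulVec] at this
    simpa using congrFun this i
  have h2 := h.dotProduct_mulVec_pos hv
  have h3 := quadForm_odiag (U := U) a (WithLp.toLp 2 (U *ᵥ Pi.single i 1))
  simp only [quadForm, Matrix.mulVec_mulVec, hU', Matrix.one_mulVec] at h3
  simp only [star_trivial, Matrix.mulVec_mulVec] at h2
  rw [h3] at h2
  simpa [Pi.single_apply, ite_pow] using h2

end Odiag

/-! ### The closed form in an orthonormal basis of common eigenvectors -/

/-- The eigenvalue of `κ Ξ` that belongs to the eigenvalues `p` of `κ Σ₀` and `q` of `κ Σ₁`. -/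
def xiScalar (lam p q : ℝ) : ℝ :=
  q * Real.log (q / p) + (q + lam) * Real.log ((p + lam) / (q + lam))

/-- The contribution to the divergence of one coordinate, in which the variances are `p`, `q`, and
the means differ by `δ`. -/
def coordValue (lam p q δ : ℝ) : ℝ :=
  xiScalar lam p q / (4 * lam) +
    if p = q then δ ^ 2 / (2 * (p + lam))
    else xiScalar lam p q / (4 * lam) * δ ^ 2 / (√q - √p) ^ 2

/-- All matrices involved are diagonal in the basis U, so the identity can be checked eigenvalue by
eigenvalue. -/
theorem closedForm_eq_sum {d : ℕ} {U : Matrix (Fin d) (Fin d) ℝ} (hU : U * Uᵀ = 1)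
    (hU' : Uᵀ * U = 1) {a b : Fin d → ℝ} (ha : ∀ i, 0 < a i) (hb : ∀ i, 0 < b i) {κ lam : ℝ}
    (hκ : 0 < κ) (hlam : 0 < lam) (x : E d) :
    κ / (4 * lam) * (Xi κ lam (odiag U a) (odiag U b)).trace +
        1 / 2 * quadForm
          (projPerp (odiag U a) (odiag U b) * (inflate κ lam (odiag U a))⁻¹ *
              projPerp (odiag U a) (odiag U b) +
            (1 / (2 * lam)) • (proj (odiag U a) (odiag U b) * Xi κ lam (odiag U a) (odiag U b) *
              proj (odiag U a) (odiag U b) *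
              pinv (msqrt (odiag U b) - msqrt (odiag U a)) ^ 2)) x =
      ∑ i, coordValue lam (κ * a i) (κ * b i) ((Uᵀ *ᵥ x.ofLp) i) := by
  have hpos : ∀ r : ℝ, 0 < r → 0 < κ * r + lam := fun r hr => by positivity
  have hinf : ∀ c : Fin d → ℝ, inflate κ lam (odiag U c) = odiag U (fun i => κ * c i + lam) :=
    fun c => by
      rw [inflate, ← odiag_one hU, smul_odiag, smul_odiag, odiag_add]; simp
  have hinv := odiag_inv hU hU' (fun i => (hpos _ (ha i)).ne')
  have hXi : Xi κ lam (odiag U a) (odiag U b) =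
      odiag U (fun i => κ⁻¹ * xiScalar lam (κ * a i) (κ * b i)) := by
    rw [Xi, hinf, hinf, odiag_inv hU hU' (fun i => (ha i).ne'),
      odiag_inv hU hU' (fun i => (hpos _ (hb i)).ne'), odiag_mul hU', odiag_mul hU', mlog, mlog,
      cfc_odiag hU hU', cfc_odiag hU hU', odiag_mul hU', odiag_mul hU', smul_odiag, odiag_add]
    congr 1; ext i
    rw [xiScalar, mul_div_mul_left _ _ hκ.ne', div_eq_mul_inv, div_eq_mul_inv]
    field_simp
  -- Since `0⁻¹ = 0`, this eigenvalue is 0 where a i = b i and 1 elsewhere; this produces the two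
  -- branches of `coordValue`.
  have hproj : proj (odiag U a) (odiag U b) = odiag U (fun i => (b i - a i) * (b i - a i)⁻¹) := by
    rw [proj, pinv, odiag_sub, cfc_odiag hU hU', odiag_mul hU']
  rw [projPerp, hproj, hinf, hinv, hXi, msqrt, msqrt, cfc_odiag hU hU', cfc_odiag hU hU', odiag_sub,
    pinv, cfc_odiag hU hU', odiag_pow hU hU', ← odiag_one hU, odiag_sub]
  simp only [odiag_mul hU', smul_odiag, odiag_add]
  rw [odiag_trace hU', quadForm_odiag, Finset.mul_sum, Finset.mul_sum, ← Finset.sum_add_distrib]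
  refine Finset.sum_congr rfl fun i _ => ?_
  have hs : ∀ r, √(κ * r) = √κ * √r := fun r => Real.sqrt_mul hκ.le r
  have h1 := hpos _ (ha i)
  by_cases hab : a i = b i
  · rw [coordValue, if_pos (by rw [hab])]
    simp only [hab, sub_self, zero_mul] at h1 ⊢
    field_simp
    ring
  · rw [coordValue, if_neg (fun h => hab (mul_left_cancel₀ hκ.ne' h)), hs, hs,
      mul_inv_cancel₀ (sub_ne_zero.mpr (Ne.symm hab))]
    have hne : √(b i) - √(a i) ≠ 0 := fun h =>
      hab ((Real.sqrt_inj (ha i).le (hb i).le).mp (sub_eq_zero.mp h).symm)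
    -- `coordValue` takes roots of the variances κa, κb, the formula takes roots of a, b; the
    -- resulting factor κ matches the factor κ⁻¹ in the eigenvalue of Ξ.
    have e : (√κ * √(b i) - √κ * √(a i)) ^ 2 = κ * (√(b i) - √(a i)) ^ 2 := by
      rw [← mul_sub, mul_pow, Real.sq_sqrt hκ.le]
    rw [e]
    field_simp
    ring

/-! ### Linear differential equations with continuous coefficients -/

section LinearODE

variable {V : Type*} [NormedAddCommGroup V] [NormedSpace ℝ V]

/-- The terms of the Picard series of `x' = L x`. -/
def picardTerm (L : ℝ → V →L[ℝ] V) (x₀ : V) : ℕ → ℝ → V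
  | 0 => fun _ => x₀
  | n + 1 => fun t => ∫ s in (0 : ℝ)..t, L s (picardTerm L x₀ n s)

theorem continuous_picardTerm {L : ℝ → V →L[ℝ] V} (hL : Continuous L) (x₀ : V) (n : ℕ) :
    Continuous (picardTerm L x₀ n) := by
  induction n with
  | zero => exact continuous_const
  | succ n ih =>
    exact intervalIntegral.continuous_primitive
      (fun a b => (hL.clm_apply ih).intervalIntegrable a b) 0

theorem hasDerivAt_picardTerm_succ [CompleteSpace V] {L : ℝ → V →L[ℝ] V} (hL : Continuous L)
    (x₀ : V) (n : ℕ) (t : ℝ) :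
    HasDerivAt (picardTerm L x₀ (n + 1)) (L t (picardTerm L x₀ n t)) t := by
  have hc : Continuous fun s => L s (picardTerm L x₀ n s) :=
    hL.clm_apply (continuous_picardTerm hL x₀ n)
  exact intervalIntegral.integral_hasDerivAt_right (hc.intervalIntegrable 0 t)
    hc.stronglyMeasurable.stronglyMeasurableAtFilter hc.continuousAt

/-- Each integration raises the power of |t| and divides by the new exponent, which builds up the
exponential series. -/
theorem norm_picardTerm_le {L : ℝ → V →L[ℝ] V} (hL : Continuous L) {K : ℝ} (hK : ∀ t, ‖L t‖ ≤ K)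
    (x₀ : V) (n : ℕ) (t : ℝ) :
    ‖picardTerm L x₀ n t‖ ≤ ‖x₀‖ * ((K * |t|) ^ n / n.factorial) := by
  have hK0 : 0 ≤ K := (norm_nonneg _).trans (hK 0)
  induction n generalizing t with
  | zero => simp [picardTerm]
  | succ n ih =>
    have hc : Continuous fun s => L s (picardTerm L x₀ n s) :=
      hL.clm_apply (continuous_picardTerm hL x₀ n)
    calc ‖picardTerm L x₀ (n + 1) t‖ ≤ ∫ s in uIoc (0 : ℝ) t, ‖L s (picardTerm L x₀ n s)‖ :=
          intervalIntegral.norm_integral_le_integral_norm_uIoc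
      _ ≤ ∫ s in uIoc (0 : ℝ) t, (‖x₀‖ * K ^ (n + 1) / n.factorial) * |s - 0| ^ n := by
          refine integral_mono (hc.norm.integrableOn_uIoc)
            ((Continuous.integrableOn_uIoc (by fun_prop))) fun s => ?_
          calc ‖L s (picardTerm L x₀ n s)‖ ≤ K * (‖x₀‖ * ((K * |s|) ^ n / n.factorial)) :=
                ((L s).le_opNorm _).trans (mul_le_mul (hK s) (ih s) (norm_nonneg _) hK0)
            _ = _ := by rw [sub_zero, mul_pow, pow_succ]; ring
      _ = _ := by
          rw [integral_const_mul, integral_pow_abs_sub_uIoc, Nat.factorial_succ, sub_zero, mul_pow]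
          push_cast
          field_simp

/-- The Picard series is dominated by the exponential series of K|t|, so it converges for all times
and may be differentiated term by term. -/
theorem exists_hasDerivAt_linear [CompleteSpace V] {L : ℝ → V →L[ℝ] V} (hL : Continuous L) {K : ℝ}
    (hK : ∀ t, ‖L t‖ ≤ K) (x₀ : V) :
    ∃ x : ℝ → V, x 0 = x₀ ∧ ∀ t, HasDerivAt x (L t (x t)) t := by
  have hK0 : 0 ≤ K := (norm_nonneg _).trans (hK 0)
  have hsum : ∀ t, Summable fun n => picardTerm L x₀ n t := fun t =>
    Summable.of_norm_bounded ((Real.summable_pow_div_factorial (K * |t|)).mul_left ‖x₀‖)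
      fun n => norm_picardTerm_le hL hK x₀ n t
  refine ⟨fun t => ∑' n, picardTerm L x₀ n t, ?_, fun t => ?_⟩
  · change ∑' n, picardTerm L x₀ n 0 = x₀
    rw [tsum_eq_single 0]
    · rfl
    · rintro (_ | n) hn
      · exact absurd rfl hn
      · exact intervalIntegral.integral_same
  · have hsucc : HasDerivAt (fun z => ∑' n, picardTerm L x₀ (n + 1) z)
        (∑' n, L t (picardTerm L x₀ n t)) t := by
      -- Termwise differentiation needs a bound uniform in time; it is taken on a ball around 0 that
      -- contains t.
      set R := |t| + 1
      refine hasDerivAt_tsum_of_isPreconnected (t := Metric.ball (0 : ℝ) R) (y₀ := t)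
        (g := fun n z => picardTerm L x₀ (n + 1) z) (g' := fun n z => L z (picardTerm L x₀ n z))
        (u := fun n => K * (‖x₀‖ * ((K * R) ^ n / n.factorial)))
        (((Real.summable_pow_div_factorial (K * R)).mul_left ‖x₀‖).mul_left K)
        Metric.isOpen_ball (convex_ball 0 R).isPreconnected
        (fun n y _ => hasDerivAt_picardTerm_succ hL x₀ n y) (fun n y hy => ?_) ?_
        ((summable_nat_add_iff (f := fun n => picardTerm L x₀ n t) 1).mpr (hsum t)) ?_
      · have hy' : |y| ≤ R := by simpa using (mem_ball_zero_iff.mp hy).le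
        refine ((L y).le_opNorm _).trans
          (mul_le_mul (hK y) ((norm_picardTerm_le hL hK x₀ n y).trans ?_) (norm_nonneg _) hK0)
        gcongr
      · simp [R]
      · simp [R]
    rw [← (L t).map_tsum (hsum t)] at hsucc
    have heq : (fun z => ∑' n, picardTerm L x₀ n z) =
        fun z => x₀ + ∑' n, picardTerm L x₀ (n + 1) z := by
      ext z
      rw [(hsum z).tsum_eq_zero_add]; rfl
    have := hsucc.const_add x₀
    rw [← heq] at this
    exact this

end LinearODE

/-- The resolvent of `x' = M x` in a Banach algebra, together with its inverse. -/
theorem exists_resolvent {𝔸 : Type*} [NormedRing 𝔸] [NormedAlgebra ℝ 𝔸] [CompleteSpace 𝔸]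
    {M : ℝ → 𝔸} (hM : Continuous M) {K : ℝ} (hK : ∀ t, ‖M t‖ ≤ K) :
    ∃ A N : ℝ → 𝔸, A 0 = 1 ∧ N 0 = 1 ∧
      (∀ t, HasDerivAt A (M t * A t) t) ∧ (∀ t, HasDerivAt N (-(N t * M t)) t) ∧
      (∀ t, N t * A t = 1) := by
  obtain ⟨A, hA0, hA⟩ := exists_hasDerivAt_linear (L := fun t => ContinuousLinearMap.mul ℝ 𝔸 (M t))
    ((ContinuousLinearMap.mul ℝ 𝔸).continuous.comp hM) (K := K)
    (fun t => (ContinuousLinearMap.opNorm_mul_apply_le ℝ 𝔸 _).trans (hK t)) 1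
  obtain ⟨N, hN0, hN⟩ := exists_hasDerivAt_linear
    (L := fun t => (ContinuousLinearMap.mul ℝ 𝔸).flip (-M t))
    ((ContinuousLinearMap.mul ℝ 𝔸).flip.continuous.comp hM.neg) (K := K)
    (fun t => ContinuousLinearMap.opNorm_le_bound _ ((norm_nonneg _).trans (hK 0)) fun x => by
      rw [ContinuousLinearMap.flip_apply, ContinuousLinearMap.mul_apply', mul_neg, norm_neg,
        mul_comm K]
      exact (norm_mul_le _ _).trans (mul_le_mul_of_nonneg_left (hK t) (norm_nonneg _))) 1
  have hN' : ∀ t, HasDerivAt N (-(N t * M t)) t := fun t => by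
    refine (hN t).congr_deriv ?_
    rw [ContinuousLinearMap.flip_apply, ContinuousLinearMap.mul_apply', mul_neg]
  refine ⟨A, N, hA0, hN0, hA, hN', fun t => ?_⟩
  -- N was made to solve N' = -NM so that N A is constant; no uniqueness theorem for the equation is
  -- used.
  have hd : ∀ t, HasDerivAt (fun s => N s * A s) 0 t := fun t => by
    refine ((hN' t).mul (hA t)).congr_deriv ?_
    rw [ContinuousLinearMap.mul_apply', neg_mul, mul_assoc, neg_add_cancel]
  have := is_const_of_deriv_eq_zero (fun t => (hd t).differentiableAt) (fun t => (hd t).deriv) t 0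
  rw [this, hA0, hN0, one_mul]

/-! ### Moments of densities and their behaviour under affine maps -/

section Moments

variable {d : ℕ}

/-- `act`, as a continuous linear map in the matrix. -/
def actL : Matrix (Fin d) (Fin d) ℝ →L[ℝ] E d →L[ℝ] E d :=
  LinearMap.toContinuousLinearMap
    (Matrix.toEuclideanCLM (n := Fin d) (𝕜 := ℝ)).toAlgEquiv.toLinearEquiv.toLinearMap

theorem actL_apply (A : Matrix (Fin d) (Fin d) ℝ) (x : E d) : actL A x = act A x := rfl

theorem act_add (A : Matrix (Fin d) (Fin d) ℝ) (x y : E d) : act A (x + y) = act A x + act A y :=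
  map_add (actL A) x y

theorem act_sub (A : Matrix (Fin d) (Fin d) ℝ) (x y : E d) : act A (x - y) = act A x - act A y :=
  map_sub (actL A) x y

theorem act_mul (A B : Matrix (Fin d) (Fin d) ℝ) (x : E d) : act (A * B) x = act A (act B x) := by
  simp [act]

theorem act_one (x : E d) : act 1 x = x := by
  simp [act]

theorem act_apply (A : Matrix (Fin d) (Fin d) ℝ) (x : E d) (i : Fin d) :
    act A x i = ∑ j, A i j * x j := rfl

theorem det_actL (A : Matrix (Fin d) (Fin d) ℝ) : (actL A).det = A.det := by
  change (Matrix.toEuclideanCLM (n := Fin d) (𝕜 := ℝ) A).det = A.det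
  rw [ContinuousLinearMap.det, Matrix.coe_toEuclideanCLM_eq_toEuclideanLin]
  simp

theorem act_affine_bijective {A : Matrix (Fin d) (Fin d) ℝ} (hA : A.det ≠ 0) (a : E d) :
    Function.Bijective fun y => act A y + a := by
  have hu : IsUnit A.det := isUnit_iff_ne_zero.mpr hA
  refine Function.bijective_iff_has_inverse.mpr ⟨fun x => act A⁻¹ (x - a), fun y => ?_, fun x => ?_⟩
  · simp only [add_sub_cancel_right]
    rw [← act_mul, Matrix.nonsing_inv_mul _ hu, act_one]
  · simp only
    rw [← act_mul, Matrix.mul_nonsing_inv _ hu, act_one, sub_add_cancel]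

theorem hasFDerivAt_act_affine (A : Matrix (Fin d) (Fin d) ℝ) (a x : E d) :
    HasFDerivAt (fun y => act A y + a) (actL A) x :=
  (actL A).hasFDerivAt.add_const a

theorem integral_eq_comp_affine {A : Matrix (Fin d) (Fin d) ℝ} (hA : A.det ≠ 0) (a : E d)
    (φ : E d → ℝ) : ∫ x, φ x = ∫ y, |A.det| * φ (act A y + a) := by
  have hb := act_affine_bijective hA a
  have := integral_image_eq_integral_abs_det_fderiv_smul volume MeasurableSet.univ
    (fun x _ => (hasFDerivAt_act_affine A a x).hasFDerivWithinAt) hb.injective.injOn φ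
  simpa [image_univ, hb.surjective.range_eq, det_actL] using this

theorem integrable_iff_comp_affine {A : Matrix (Fin d) (Fin d) ℝ} (hA : A.det ≠ 0) (a : E d)
    (φ : E d → ℝ) : Integrable φ ↔ Integrable fun y => |A.det| * φ (act A y + a) := by
  have hb := act_affine_bijective hA a
  have := integrableOn_image_iff_integrableOn_abs_det_fderiv_smul volume MeasurableSet.univ
    (fun x _ => (hasFDerivAt_act_affine A a x).hasFDerivWithinAt) hb.injective.injOn φ
  simpa [image_univ, hb.surjective.range_eq, det_actL] using this

/-- `ρ` is integrable with integral one, mean `m` and covariance `C`, all moments involved being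
finite. -/
structure HasMoments (ρ : E d → ℝ) (m : E d) (C : Matrix (Fin d) (Fin d) ℝ) : Prop where
  integrable : Integrable ρ
  integral_eq_one : ∫ x, ρ x = 1
  integrable_fst : ∀ i, Integrable fun x => (x i - m i) * ρ x
  integral_fst : ∀ i, ∫ x, (x i - m i) * ρ x = 0
  integrable_snd : ∀ i j, Integrable fun x => (x i - m i) * (x j - m j) * ρ x
  integral_snd : ∀ i j, ∫ x, (x i - m i) * (x j - m j) * ρ x = C i j

variable {ρ ρ₀ : E d → ℝ} {m : E d} {C : Matrix (Fin d) (Fin d) ℝ}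

theorem HasMoments.congr_ae (h : HasMoments ρ m C) (hρ : ρ =ᵐ[volume] ρ₀) : HasMoments ρ₀ m C := by
  have key : ∀ w : E d → ℝ, (fun x => w x * ρ x) =ᵐ[volume] fun x => w x * ρ₀ x := fun w => by
    filter_upwards [hρ] with x hx; rw [hx]
  exact ⟨h.integrable.congr hρ, by rw [← h.integral_eq_one, integral_congr_ae hρ],
    fun i => (h.integrable_fst i).congr (key _),
    fun i => by rw [← h.integral_fst i, integral_congr_ae (key _)],
    fun i j => (h.integrable_snd i j).congr (key _),
    fun i j => by rw [← h.integral_snd i j, integral_congr_ae (key _)]⟩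

theorem HasMoments.mean_eq (h : HasMoments ρ m C) (i : Fin d) : mean ρ i = m i := by
  have h1 := h.integral_fst i
  have h2 : ∫ x, ((x i - m i) * ρ x + m i * ρ x) = m i := by
    rw [integral_add (h.integrable_fst i) (h.integrable.const_mul _), h1, integral_const_mul,
      h.integral_eq_one]; ring
  rw [← h2, mean]
  congr 1; ext x; ring

theorem HasMoments.cov_eq (h : HasMoments ρ m C) : cov ρ = C := by
  ext i j
  rw [cov, Matrix.of_apply, h.mean_eq, h.mean_eq, h.integral_snd]

theorem HasMoments.mean_unique {m' : E d} {C' : Matrix (Fin d) (Fin d) ℝ} (h : HasMoments ρ m C)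
    (h' : HasMoments ρ m' C') : m = m' := by
  ext i
  rw [← h.mean_eq, h'.mean_eq]

theorem integrable_fst_snd (h0 : Integrable ρ) (hpos : ∀ x, 0 ≤ ρ x)
    (h2 : Integrable fun x => ‖x‖ ^ 2 * ρ x) :
    (∀ i, Integrable fun x : E d => x i * ρ x) ∧
      ∀ i j, Integrable fun x : E d => x i * x j * ρ x := by
  have hco : ∀ i, Continuous fun x : E d => x i := fun i => by fun_prop
  have hle : ∀ (x : E d) i, |x i| ≤ ‖x‖ := fun x i => PiLp.norm_apply_le x i
  constructor
  · intro i
    refine (h0.add h2).mono' ((hco i).aestronglyMeasurable.mul h0.aestronglyMeasurable) ?_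
    refine Filter.Eventually.of_forall fun x => ?_
    rw [norm_mul, Real.norm_eq_abs, Real.norm_eq_abs, abs_of_nonneg (hpos x)]
    have : |x i| ≤ 1 + ‖x‖ ^ 2 := by nlinarith [hle x i, norm_nonneg x, sq_nonneg (‖x‖ - 1)]
    calc |x i| * ρ x ≤ (1 + ‖x‖ ^ 2) * ρ x := mul_le_mul_of_nonneg_right this (hpos x)
      _ = _ := by simp only [Pi.add_apply]; ring
  · intro i j
    refine h2.mono' (((hco i).mul (hco j)).aestronglyMeasurable.mul h0.aestronglyMeasurable) ?_
    refine Filter.Eventually.of_forall fun x => ?_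
    rw [norm_mul, norm_mul, Real.norm_eq_abs, Real.norm_eq_abs, Real.norm_eq_abs,
      abs_of_nonneg (hpos x), sq]
    exact mul_le_mul_of_nonneg_right (mul_le_mul (hle x i) (hle x j) (abs_nonneg _) (norm_nonneg _))
      (hpos x)

theorem hasMoments_of_second_moment (hpos : ∀ x, 0 ≤ ρ x) (h1 : ∫ x, ρ x = 1)
    (h2 : Integrable fun x => ‖x‖ ^ 2 * ρ x) :
    HasMoments ρ (WithLp.toLp 2 (mean ρ)) (cov ρ) := by
  have h0 : Integrable ρ := by
    -- The Bochner integral of a nonintegrable function is 0, so integral 1 already contains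
    -- integrability.
    by_contra h
    rw [integral_undef h] at h1
    exact zero_ne_one h1
  obtain ⟨hf, hs⟩ := integrable_fst_snd h0 hpos h2
  refine ⟨h0, h1, fun i => ?_, fun i => ?_, fun i j => ?_, fun i j => rfl⟩
  · refine ((hf i).sub (h0.const_mul (mean ρ i))).congr (Filter.Eventually.of_forall fun x => ?_)
    simp only [Pi.sub_apply]; ring
  · have : ∫ x : E d, (x i * ρ x - mean ρ i * ρ x) = 0 := by
      rw [integral_sub (hf i) (h0.const_mul _), integral_const_mul, h1, mul_one]
      exact sub_self _
    rw [← this]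
    congr 1; ext x; ring
  · refine ((((hs i j).sub ((hf i).const_mul (mean ρ j))).sub ((hf j).const_mul (mean ρ i))).add
      (h0.const_mul (mean ρ i * mean ρ j))).congr (Filter.Eventually.of_forall fun x => ?_)
    simp only [Pi.sub_apply, Pi.add_apply]; ring

theorem IsSmoothPosDensity.hasMoments (h : IsSmoothPosDensity ρ) :
    HasMoments ρ (WithLp.toLp 2 (mean ρ)) (cov ρ) :=
  hasMoments_of_second_moment (fun x => (h.pos x).le) h.integral_eq_one h.second_moment

/-- Expectation of a quadratic function. -/
theorem HasMoments.integral_quadratic (h : HasMoments ρ m C) (Q : Matrix (Fin d) (Fin d) ℝ)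
    (l : Fin d → ℝ) (k : ℝ) :
    (Integrable fun x : E d => (∑ i, ∑ j, Q i j * ((x i - m i) * (x j - m j)) +
        ∑ i, l i * (x i - m i) + k) * ρ x) ∧
      ∫ x : E d, (∑ i, ∑ j, Q i j * ((x i - m i) * (x j - m j)) +
        ∑ i, l i * (x i - m i) + k) * ρ x = ∑ i, ∑ j, Q i j * C i j + k := by
  have e : (fun x : E d => (∑ i, ∑ j, Q i j * ((x i - m i) * (x j - m j)) +
        ∑ i, l i * (x i - m i) + k) * ρ x) = fun x =>
      (∑ i, ∑ j, Q i j * ((x i - m i) * (x j - m j) * ρ x) +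
        ∑ i, l i * ((x i - m i) * ρ x)) + k * ρ x := by
    ext x
    rw [add_mul, add_mul, Finset.sum_mul, Finset.sum_mul]
    simp only [Finset.sum_mul, mul_assoc]
  have i2 : ∀ i j, Integrable fun x : E d => Q i j * ((x i - m i) * (x j - m j) * ρ x) :=
    fun i j => (h.integrable_snd i j).const_mul _
  have i2' : ∀ i, Integrable fun x : E d => ∑ j, Q i j * ((x i - m i) * (x j - m j) * ρ x) :=
    fun i => integrable_finsetSum _ fun j _ => i2 i j
  have i2s : Integrable fun x : E d => ∑ i, ∑ j, Q i j * ((x i - m i) * (x j - m j) * ρ x) :=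
    integrable_finsetSum _ fun i _ => i2' i
  have i1 : ∀ i, Integrable fun x : E d => l i * ((x i - m i) * ρ x) :=
    fun i => (h.integrable_fst i).const_mul _
  have i1s : Integrable fun x : E d => ∑ i, l i * ((x i - m i) * ρ x) :=
    integrable_finsetSum _ fun i _ => i1 i
  have i0 : Integrable fun x : E d => k * ρ x := h.integrable.const_mul k
  rw [e]
  have i21 : Integrable fun x : E d => ∑ i, ∑ j, Q i j * ((x i - m i) * (x j - m j) * ρ x) +
      ∑ i, l i * ((x i - m i) * ρ x) := i2s.add i1s
  refine ⟨i21.add i0, ?_⟩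
  have s2 : ∫ x : E d, ∑ i, ∑ j, Q i j * ((x i - m i) * (x j - m j) * ρ x) =
      ∑ i, ∑ j, Q i j * C i j := by
    rw [integral_finsetSum _ fun i _ => i2' i]
    refine Finset.sum_congr rfl fun i _ => ?_
    rw [integral_finsetSum _ fun j _ => i2 i j]
    refine Finset.sum_congr rfl fun j _ => ?_
    rw [integral_const_mul, h.integral_snd]
  have s1 : ∫ x : E d, ∑ i, l i * ((x i - m i) * ρ x) = 0 := by
    rw [integral_finsetSum _ fun i _ => i1 i]
    refine Finset.sum_eq_zero fun i _ => ?_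
    rw [integral_const_mul, h.integral_fst, mul_zero]
  rw [integral_add i21 i0, integral_add i2s i1s, s2, s1, integral_const_mul,
    h.integral_eq_one, add_zero, mul_one]

theorem HasMoments.second_moment (h : HasMoments ρ m C) : Integrable fun x => ‖x‖ ^ 2 * ρ x := by
  refine (h.integral_quadratic 1 (fun i => 2 * m i) (∑ i, m i ^ 2)).1.congr
    (Filter.Eventually.of_forall fun x => ?_)
  simp only [Matrix.one_apply, ite_mul, one_mul, zero_mul, Finset.sum_ite_eq, Finset.mem_univ,
    if_true]
  rw [EuclideanSpace.norm_sq_eq, ← Finset.sum_add_distrib, ← Finset.sum_add_distrib]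
  congr 1
  refine Finset.sum_congr rfl fun i _ => ?_
  rw [Real.norm_eq_abs, sq_abs]; ring

/-- The hypothesis says that ρ is the density of Ay + a when y has density ρ₀. Centred coordinates
transform linearly under this map, so the new moments are expectations of quadratic functions under
ρ₀. -/
theorem HasMoments.transport (h : HasMoments ρ₀ m C) {A : Matrix (Fin d) (Fin d) ℝ}
    (hA : A.det ≠ 0) {a : E d} (hρ : ∀ y, ρ (act A y + a) * |A.det| = ρ₀ y) :
    HasMoments ρ (act A m + a) (A * C * Aᵀ) := by
  have hintegral : ∀ w : E d → ℝ, ∫ x, w x * ρ x = ∫ y, w (act A y + a) * ρ₀ y := fun w => by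
    rw [integral_eq_comp_affine hA a]
    congr 1; ext y; rw [← hρ]; ring
  have hintegrable : ∀ w : E d → ℝ, (Integrable fun x => w x * ρ x) ↔
      Integrable fun y => w (act A y + a) * ρ₀ y := fun w => by
    rw [integrable_iff_comp_affine hA a]
    have : (fun y => |A.det| * (w (act A y + a) * ρ (act A y + a))) =
        fun y => w (act A y + a) * ρ₀ y := by ext y; rw [← hρ]; ring
    rw [this]
  have hc : ∀ (y : E d) i, (act A y + a) i - (act A m + a) i = ∑ k, A i k * (y k - m k) :=
    fun y i => by
      simp only [PiLp.add_apply, act_apply, mul_sub, Finset.sum_sub_distrib]; ring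
  have h1 : ∀ i, (fun y : E d => ((act A y + a) i - (act A m + a) i) * ρ₀ y) =
      fun y => (∑ k, ∑ l, (0 : Matrix (Fin d) (Fin d) ℝ) k l * ((y k - m k) * (y l - m l)) +
        ∑ k, A i k * (y k - m k) + 0) * ρ₀ y := fun i => by
    ext y; rw [hc]; simp
  have h2 : ∀ i j, (fun y : E d => ((act A y + a) i - (act A m + a) i) *
      ((act A y + a) j - (act A m + a) j) * ρ₀ y) =
      fun y => (∑ k, ∑ l, (Matrix.of fun k l => A i k * A j l) k l * ((y k - m k) * (y l - m l)) +
        ∑ k, (0 : Fin d → ℝ) k * (y k - m k) + 0) * ρ₀ y := fun i j => by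
    ext y
    rw [hc, hc, Finset.sum_mul_sum]
    simp only [Matrix.of_apply, Pi.zero_apply, zero_mul, Finset.sum_const_zero, add_zero]
    congr 1
    refine Finset.sum_congr rfl fun k _ => Finset.sum_congr rfl fun l _ => by ring
  refine ⟨?_, ?_, fun i => ?_, fun i => ?_, fun i j => ?_, fun i j => ?_⟩
  · have := (hintegrable fun _ => 1).mpr (by simpa using h.integrable)
    simpa using this
  · have := hintegral fun _ => 1
    simp only [one_mul] at this
    rw [this, h.integral_eq_one]
  · rw [hintegrable fun x => x i - (act A m + a) i, h1]
    exact (h.integral_quadratic _ _ _).1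
  · rw [hintegral fun x => x i - (act A m + a) i, h1, (h.integral_quadratic _ _ _).2]
    simp
  · rw [hintegrable fun x => (x i - (act A m + a) i) * (x j - (act A m + a) j), h2]
    exact (h.integral_quadratic _ _ _).1
  · rw [hintegral fun x => (x i - (act A m + a) i) * (x j - (act A m + a) j), h2,
      (h.integral_quadratic _ _ _).2]
    simp only [Matrix.mul_apply, Matrix.of_apply, Matrix.transpose_apply, Finset.sum_mul, add_zero]
    rw [Finset.sum_comm]
    refine Finset.sum_congr rfl fun k _ => Finset.sum_congr rfl fun l _ => by ring

theorem inner_act_eq_quadForm (A : Matrix (Fin d) (Fin d) ℝ) (x : E d) :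
    inner ℝ x (act A x) = quadForm A x :=
  Matrix.inner_toEuclideanCLM A x x

/-- Expectation of a quadratic form in an affine function. -/
theorem HasMoments.integral_quadForm_affine (h : HasMoments ρ m C)
    (K B : Matrix (Fin d) (Fin d) ℝ) (b : E d) :
    (Integrable fun x => quadForm K (act B x + b) * ρ x) ∧
      ∫ x, quadForm K (act B x + b) * ρ x =
        (Bᵀ * K * B * Cᵀ).trace + quadForm K (act B m + b) := by
  set u : E d := act B m + b with hu
  have e : ∀ x : E d, quadForm K (act B x + b) =
      ∑ i, ∑ j, (Bᵀ * K * B) i j * ((x i - m i) * (x j - m j)) +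
        ∑ i, (Bᵀ *ᵥ (K *ᵥ u.ofLp) + (u.ofLp ᵥ* K) ᵥ* B) i * (x i - m i) + quadForm K u := fun x => by
    -- Expanding around the mean makes the linear part integrate to zero, so its coefficients never
    -- need to be simplified.
    have hx : act B x + b = act B (x - m) + u := by rw [hu, act_sub]; abel
    have h1 : ∀ y : E d, y.ofLp ⬝ᵥ ((Bᵀ * K * B) *ᵥ y.ofLp) =
        ∑ i, ∑ j, (Bᵀ * K * B) i j * (y i * y j) := fun y => by
      simp only [dotProduct, Matrix.mulVec, Finset.mul_sum]
      refine Finset.sum_congr rfl fun k _ => Finset.sum_congr rfl fun l _ => by ring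
    have h2 := h1 (x - m)
    have h3 : ∑ i, (Bᵀ *ᵥ (K *ᵥ u.ofLp) + (u.ofLp ᵥ* K) ᵥ* B) i * (x i - m i) =
      (Bᵀ *ᵥ (K *ᵥ u.ofLp) + (u.ofLp ᵥ* K) ᵥ* B) ⬝ᵥ (x - m).ofLp := rfl
    rw [h3, hx]
    simp only [PiLp.sub_apply] at h2
    rw [← h2]
    simp only [quadForm, act, WithLp.ofLp_add, Matrix.mulVec_add, add_dotProduct, dotProduct_add,
      ← Matrix.mulVec_mulVec]
    set y := (x - m).ofLp
    have e1 : B *ᵥ y ⬝ᵥ K *ᵥ B *ᵥ y = y ⬝ᵥ Bᵀ *ᵥ K *ᵥ B *ᵥ y := by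
      rw [Matrix.dotProduct_mulVec y, Matrix.vecMul_transpose]
    have e2 : B *ᵥ y ⬝ᵥ K *ᵥ u.ofLp = Bᵀ *ᵥ K *ᵥ u.ofLp ⬝ᵥ y := by
      rw [dotProduct_comm _ y, Matrix.dotProduct_mulVec y, Matrix.vecMul_transpose]
    have e3 : u.ofLp ⬝ᵥ K *ᵥ B *ᵥ y = (u.ofLp ᵥ* K) ᵥ* B ⬝ᵥ y := by
      rw [Matrix.dotProduct_mulVec, Matrix.dotProduct_mulVec]
    rw [e1, e2, e3]; ring
  simp only [e]
  obtain ⟨h1, h2⟩ := h.integral_quadratic (Bᵀ * K * B)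
    (Bᵀ *ᵥ (K *ᵥ u.ofLp) + (u.ofLp ᵥ* K) ᵥ* B) (quadForm K u)
  exact ⟨h1, h2.trans (by congr 1)⟩

end Moments

/-! ### Elliptic densities -/

section Elliptic

variable {d : ℕ} {g : ℝ → ℝ}

/-- For d = 0 the convention Γ(0) = 0 and division by zero make the left side of the normalization
0, not 1. -/
theorem IsGenerator.dim_pos (h : IsGenerator d g) : 0 < d := by
  rcases Nat.eq_zero_or_pos d with rfl | h0
  · have := h.normalized
    simp [Real.Gamma_zero] at this
  · exact h0

theorem rpow_two_substitution (s : ℝ) {x : ℝ} (hx : 0 < x) (g : ℝ → ℝ) :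
    x ^ ((2 : ℝ) - 1) • ((x ^ (2 : ℝ)) ^ s * g (x ^ (2 : ℝ))) =
      x ^ (2 * s + 1) * g (x ^ 2) := by
  rw [← Real.rpow_mul hx.le, Real.rpow_two, smul_eq_mul, ← mul_assoc, ← Real.rpow_add hx]
  ring_nf

/-- Polar coordinates followed by r = x². The sphere has area d π^(d/2)/Γ(d/2 + 1) =
2π^(d/2)/Γ(d/2), and the substitution absorbs the factor 2. -/
theorem IsGenerator.integral_isotropic (h : IsGenerator d g) : ∫ y : E d, g (‖y‖ ^ 2) = 1 := by
  have hd := h.dim_pos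
  have : Nonempty (Fin d) := ⟨⟨0, hd⟩⟩
  have hdr : (0 : ℝ) < d := by exact_mod_cast hd
  refine Eq.trans ?_ h.normalized
  rw [integral_fun_norm_addHaar volume (fun r => g (r ^ 2)),
    ← integral_comp_rpow_Ioi_of_pos (g := fun r => r ^ ((d : ℝ) / 2 - 1) * g r) two_pos]
  have e : ∫ x in Ioi (0 : ℝ), ((2 : ℝ) * x ^ ((2 : ℝ) - 1)) •
      ((x ^ (2 : ℝ)) ^ ((d : ℝ) / 2 - 1) * g (x ^ (2 : ℝ))) =
      2 * ∫ x in Ioi (0 : ℝ), x ^ (d - 1) • g (x ^ 2) := by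
    rw [← integral_const_mul]
    refine setIntegral_congr_fun measurableSet_Ioi fun x hx => ?_
    rw [mul_smul, rpow_two_substitution _ hx, smul_eq_mul, smul_eq_mul]
    congr 2
    rw [← Real.rpow_natCast]
    congr 1
    rw [Nat.cast_sub hd]; push_cast; ring
  rw [e, finrank_euclideanSpace, Fintype.card_fin, Measure.real, EuclideanSpace.volume_ball,
    Fintype.card_fin, ENNReal.ofReal_one, one_pow, one_mul,
    ENNReal.toReal_ofReal (div_nonneg (by positivity) (Real.Gamma_pos_of_pos (by positivity)).le),
    Real.Gamma_add_one (by positivity), nsmul_eq_mul, smul_eq_mul]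
  have hpi : √Real.pi ^ d = Real.pi ^ ((d : ℝ) / 2) := by
    rw [Real.sqrt_eq_rpow, ← Real.rpow_natCast, ← Real.rpow_mul Real.pi_pos.le]
    congr 1; ring
  rw [hpi]
  have hG : Real.Gamma ((d : ℝ) / 2) ≠ 0 := (Real.Gamma_pos_of_pos (by positivity)).ne'
  field_simp

theorem IsGenerator.integrable_sq_isotropic (h : IsGenerator d g) :
    Integrable fun y : E d => ‖y‖ ^ 2 * g (‖y‖ ^ 2) := by
  have hd := h.dim_pos
  have : Nonempty (Fin d) := ⟨⟨0, hd⟩⟩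
  rw [integrable_fun_norm_addHaar volume (f := fun r => r ^ 2 * g (r ^ 2))]
  refine ((integrableOn_Ioi_comp_rpow_iff' _ two_ne_zero).mpr h.finite_variance).congr_fun
    (fun x hx => ?_) measurableSet_Ioi
  have hx' : (0 : ℝ) < x := hx
  simp only
  have hexp : x ^ (2 * ((d : ℝ) / 2) + 1) = x ^ (d - 1) * x ^ 2 := by
    rw [← pow_add, show d - 1 + 2 = d + 1 by omega, ← Real.rpow_natCast]
    push_cast
    ring_nf
  rw [rpow_two_substitution _ hx', finrank_euclideanSpace, Fintype.card_fin, smul_eq_mul,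
    ← mul_assoc, hexp]

theorem IsGenerator.smooth_isotropic (h : IsGenerator d g) :
    ContDiff ℝ ∞ fun y : E d => g (‖y‖ ^ 2) := by
  rw [← contDiffOn_univ]
  exact h.smooth.comp (contDiff_norm_sq ℝ).contDiffOn fun y _ => sq_nonneg ‖y‖

theorem IsGenerator.isSmoothPosDensity_isotropic (h : IsGenerator d g) :
    IsSmoothPosDensity fun y : E d => g (‖y‖ ^ 2) :=
  ⟨h.smooth_isotropic, fun _ => h.pos _ (sq_nonneg _), h.integral_isotropic,
    h.integrable_sq_isotropic⟩

/-- By symmetry: y ↦ -y kills the mean, the reflection of one coordinate kills the mixed moments,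
and swapping two coordinates equates the diagonal ones, each of which is then 1/d of the total. -/
theorem IsGenerator.hasMoments_isotropic (h : IsGenerator d g) :
    HasMoments (fun y : E d => g (‖y‖ ^ 2)) 0 (kappa d g • (1 : Matrix (Fin d) (Fin d) ℝ)) := by
  classical
  have hD := h.isSmoothPosDensity_isotropic
  have hM := hD.hasMoments
  obtain ⟨hf, hs⟩ := integrable_fst_snd hM.integrable (fun x => (hD.pos x).le) hD.second_moment
  have hmean : ∀ i, ∫ y : E d, y i * g (‖y‖ ^ 2) = 0 := fun i => by
    have := integral_neg_eq_self (fun y : E d => y i * g (‖y‖ ^ 2)) volume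
    simp only [norm_neg, PiLp.neg_apply, neg_mul, integral_neg] at this
    linarith
  have hoff : ∀ i j, i ≠ j → ∫ y : E d, y i * y j * g (‖y‖ ^ 2) = 0 := fun i j hij => by
    let T : E d ≃ₗᵢ[ℝ] E d := LinearIsometryEquiv.piLpCongrRight 2
      fun k : Fin d => if k = i then LinearIsometryEquiv.neg ℝ else LinearIsometryEquiv.refl ℝ ℝ
    have := T.measurePreserving.integral_comp T.toHomeomorph.measurableEmbedding
      (fun y : E d => y i * y j * g (‖y‖ ^ 2))
    have hTi : ∀ y : E d, T y i = -y i := fun y => by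
      simp [T, LinearIsometryEquiv.piLpCongrRight_apply]
    have hTj : ∀ y : E d, T y j = y j := fun y => by
      simp [T, LinearIsometryEquiv.piLpCongrRight_apply, hij.symm]
    simp only [LinearIsometryEquiv.norm_map, hTi, hTj, neg_mul, integral_neg] at this
    linarith
  have hswap : ∀ i j, ∫ y : E d, y i * y i * g (‖y‖ ^ 2) = ∫ y : E d, y j * y j * g (‖y‖ ^ 2) :=
    fun i j => by
      let T : E d ≃ₗᵢ[ℝ] E d := LinearIsometryEquiv.piLpCongrLeft 2 ℝ ℝ (Equiv.swap i j)
      have := T.measurePreserving.integral_comp T.toHomeomorph.measurableEmbedding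
        (fun y : E d => y i * y i * g (‖y‖ ^ 2))
      have hTi : ∀ y : E d, T y i = y j := fun y => by
        simp [T, LinearIsometryEquiv.piLpCongrLeft_apply, Equiv.piCongrLeft'_apply]
      simp only [LinearIsometryEquiv.norm_map, hTi] at this
      exact this.symm
  have hdiag : ∀ i, ∫ y : E d, y i * y i * g (‖y‖ ^ 2) = kappa d g := fun i => by
    have hd : (d : ℝ) ≠ 0 := by exact_mod_cast h.dim_pos.ne'
    have h1 : ∫ y : E d, ‖y‖ ^ 2 * g (‖y‖ ^ 2) = ∑ j, ∫ y : E d, y j * y j * g (‖y‖ ^ 2) := by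
      rw [← integral_finsetSum _ fun j _ => hs j j]
      congr 1; ext y
      rw [← Finset.sum_mul]
      congr 1
      rw [EuclideanSpace.norm_sq_eq]
      refine Finset.sum_congr rfl fun j _ => by rw [Real.norm_eq_abs, sq_abs, sq]
    rw [kappa, h1, Finset.sum_congr rfl fun j _ => hswap j i, Finset.sum_const, Finset.card_univ,
      Fintype.card_fin, nsmul_eq_mul]
    field_simp
  refine ⟨hM.integrable, hD.integral_eq_one, ?_, ?_, ?_, ?_⟩
  · simpa using hf
  · simpa using hmean
  · simpa using hs
  · intro i j
    rcases eq_or_ne i j with rfl | hij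
    · simpa using hdiag i
    · simpa [Matrix.one_apply_ne hij] using hoff i j hij

theorem IsGenerator.kappa_pos (h : IsGenerator d g) : 0 < kappa d g := by
  have hd : (0 : ℝ) < d := by exact_mod_cast h.dim_pos
  have : Nonempty (Fin d) := ⟨⟨0, h.dim_pos⟩⟩
  refine mul_pos (by positivity) ?_
  have hnn : 0 ≤ fun y : E d => ‖y‖ ^ 2 * g (‖y‖ ^ 2) := fun y =>
    mul_nonneg (sq_nonneg _) (h.pos _ (sq_nonneg _)).le
  rw [integral_pos_iff_support_of_nonneg hnn h.integrable_sq_isotropic]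
  have hsupp : Function.support (fun y : E d => ‖y‖ ^ 2 * g (‖y‖ ^ 2)) = {0}ᶜ := by
    ext y
    have := (h.pos _ (sq_nonneg ‖y‖)).ne'
    simp [this]
  rw [hsupp]
  exact isOpen_compl_singleton.measure_pos volume (exists_ne (0 : E d))

variable {U : Matrix (Fin d) (Fin d) ℝ} {a : Fin d → ℝ}

/-- `diag(a)^(-1/2) Uᵀ`, which maps `E(m, U diag(a) Uᵀ, g)` to a spherical distribution. -/
def whiten (U : Matrix (Fin d) (Fin d) ℝ) (a : Fin d → ℝ) : Matrix (Fin d) (Fin d) ℝ :=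
  Matrix.diagonal (fun i => (√(a i))⁻¹) * Uᵀ

theorem quadForm_inv_odiag (hU : U * Uᵀ = 1) (hU' : Uᵀ * U = 1) (ha : ∀ i, 0 < a i) (x : E d) :
    quadForm (odiag U a)⁻¹ x = ‖act (whiten U a) x‖ ^ 2 := by
  rw [odiag_inv hU hU' (fun i => (ha i).ne'), quadForm_odiag, EuclideanSpace.norm_sq_eq]
  refine Finset.sum_congr rfl fun i _ => ?_
  have : act (whiten U a) x i = (√(a i))⁻¹ * (Uᵀ *ᵥ x.ofLp) i := by
    change (whiten U a *ᵥ x.ofLp) i = _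
    rw [whiten, ← Matrix.mulVec_mulVec, Matrix.mulVec_diagonal]
  rw [this, Real.norm_eq_abs, sq_abs, mul_pow, inv_pow, Real.sq_sqrt (ha i).le]

theorem ellipticDensity_odiag (hU : U * Uᵀ = 1) (hU' : Uᵀ * U = 1) (ha : ∀ i, 0 < a i) (m x : E d) :
    ellipticDensity m (odiag U a) g x =
      (∏ i, (√(a i))⁻¹) * g (‖act (whiten U a) (x - m)‖ ^ 2) := by
  rw [ellipticDensity, quadForm_inv_odiag hU hU' ha, odiag_det hU]
  congr 1
  rw [← Real.finsetProd_rpow _ _ fun i _ => (ha i).le]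
  refine Finset.prod_congr rfl fun i _ => ?_
  rw [Real.rpow_neg (ha i).le, ← Real.sqrt_eq_rpow]

/-- The elliptic law is the image of the isotropic one under A = U diag(√a) and translation by m, so
its covariance is A(κI)Aᵀ = κΣ. -/
theorem hasMoments_ellipticDensity (hU : U * Uᵀ = 1) (hU' : Uᵀ * U = 1) (ha : ∀ i, 0 < a i)
    (h : IsGenerator d g) (m : E d) :
    HasMoments (ellipticDensity m (odiag U a) g) m (odiag U fun i => kappa d g * a i) := by
  set A := U * Matrix.diagonal (fun i => √(a i)) with hAdef
  have hs : ∀ i, √(a i) ≠ 0 := fun i => (Real.sqrt_pos.mpr (ha i)).ne'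
  have hdetU : |U.det| = 1 := by
    have h1 : U.det * U.det = 1 := by
      have := congrArg Matrix.det hU
      rwa [Matrix.det_mul, Matrix.det_transpose, Matrix.det_one] at this
    rcases mul_self_eq_one_iff.mp h1 with h2 | h2 <;> simp [h2]
  have hdet : |A.det| = ∏ i, √(a i) := by
    rw [hAdef, Matrix.det_mul, abs_mul, hdetU, Matrix.det_diagonal, one_mul,
      abs_of_nonneg (Finset.prod_nonneg fun i _ => Real.sqrt_nonneg _)]
  have hdet0 : A.det ≠ 0 := by
    rw [← abs_ne_zero, hdet]; exact Finset.prod_ne_zero_iff.mpr fun i _ => hs i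
  have hWA : whiten U a * A = 1 := by
    calc _ = Matrix.diagonal (fun i => (√(a i))⁻¹) * (Uᵀ * U) *
          Matrix.diagonal (fun i => √(a i)) := by simp only [whiten, hAdef, mul_assoc]
      _ = _ := by
        rw [hU', mul_one, Matrix.diagonal_mul_diagonal, ← Matrix.diagonal_one]
        congr 1; ext i; exact inv_mul_cancel₀ (hs i)
  have key := h.hasMoments_isotropic.transport (ρ := ellipticDensity m (odiag U a) g) hdet0
    (a := m) fun y => by
      rw [ellipticDensity_odiag hU hU' ha, add_sub_cancel_right, ← act_mul, hWA, act_one, hdet,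
        mul_right_comm, ← Finset.prod_mul_distrib,
        Finset.prod_eq_one fun i _ => inv_mul_cancel₀ (hs i), one_mul]
  have e1 : act A 0 + m = m := by
    have : act A 0 = 0 := map_zero (actL A)
    rw [this, zero_add]
  have e2 : A * (kappa d g • (1 : Matrix (Fin d) (Fin d) ℝ)) * Aᵀ =
      odiag U fun i => kappa d g * a i := by
    rw [Matrix.mul_smul, Matrix.smul_mul, mul_one, hAdef, Matrix.transpose_mul,
      Matrix.diagonal_transpose, ← smul_odiag, odiag]
    congr 1
    have : Matrix.diagonal a = Matrix.diagonal (fun i => √(a i)) * Matrix.diagonal fun i => √(a i) := by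
      rw [Matrix.diagonal_mul_diagonal]
      congr 1; ext i; exact (Real.mul_self_sqrt (ha i).le).symm
    rw [this]; simp only [mul_assoc]
  rwa [e1, e2] at key

theorem isSmoothPosDensity_ellipticDensity (hU : U * Uᵀ = 1) (hU' : Uᵀ * U = 1)
    (ha : ∀ i, 0 < a i) (h : IsGenerator d g) (m : E d) :
    IsSmoothPosDensity (ellipticDensity m (odiag U a) g) := by
  have hM := hasMoments_ellipticDensity hU hU' ha h m
  refine ⟨?_, fun x => ?_, hM.integral_eq_one, hM.second_moment⟩
  · rw [funext fun x => ellipticDensity_odiag (g := g) hU hU' ha m x]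
    exact contDiff_const.mul (h.smooth_isotropic.comp
      ((actL (whiten U a)).contDiff.comp (contDiff_id.sub contDiff_const)))
  · rw [ellipticDensity_odiag hU hU' ha]
    exact mul_pos (Finset.prod_pos fun i _ => inv_pos.mpr (Real.sqrt_pos.mpr (ha i)))
      (h.pos _ (sq_nonneg _))

/-- The end point conditions of a geodesic concern measures. Equality almost everywhere is enough,
since only moments are used afterwards. -/
theorem ae_eq_of_ofDensity_eq {ρ ρ' : E d → ℝ} (h : IsSmoothPosDensity ρ)
    (h' : IsSmoothPosDensity ρ') (he : ofDensity ρ = ofDensity ρ') : ρ =ᵐ[volume] ρ' := by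
  have h1 := (withDensity_eq_iff_of_sigmaFinite
    h.smooth.continuous.measurable.ennreal_ofReal.aemeasurable
    h'.smooth.continuous.measurable.ennreal_ofReal.aemeasurable).mp he
  filter_upwards [h1] with x hx
  exact (ENNReal.ofReal_eq_ofReal_iff (h.pos x).le (h'.pos x).le).mp hx

end Elliptic

/-! ### The continuity equation with an affine velocity field -/

section Continuity

variable {d : ℕ}

theorem inner_act_left {B : Matrix (Fin d) (Fin d) ℝ} (hB : B.IsSymm) (x y : E d) :
    inner ℝ (act B x) y = inner ℝ x (act B y) := by
  rw [real_inner_comm]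
  have h1 : inner ℝ y (act B x) = y.ofLp ⬝ᵥ (B *ᵥ x.ofLp) := Matrix.inner_toEuclideanCLM B y x
  have h2 : inner ℝ x (act B y) = x.ofLp ⬝ᵥ (B *ᵥ y.ofLp) := Matrix.inner_toEuclideanCLM B x y
  rw [h1, h2, Matrix.dotProduct_mulVec, ← Matrix.mulVec_transpose, hB.eq, dotProduct_comm]

theorem hasGradientAt_quadratic {B : Matrix (Fin d) (Fin d) ℝ} (hB : B.IsSymm) (b : E d) (c : ℝ)
    (x : E d) :
    HasGradientAt (fun x => 1 / 2 * quadForm B x + inner ℝ b x + c) (act B x + b) x := by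
  rw [hasGradientAt_iff_hasFDerivAt]
  have h1 := (hasFDerivAt_id (𝕜 := ℝ) x).inner ℝ (actL B).hasFDerivAt
  have he : (fun x => 1 / 2 * quadForm B x + inner ℝ b x + c) =
      fun x => 1 / 2 * inner ℝ (id x) (actL B x) + inner ℝ b x + c := by
    ext x; rw [← inner_act_eq_quadForm]; rfl
  rw [he]
  have h2 : HasFDerivAt (fun x : E d => inner ℝ b x) (innerSL ℝ b) x := (innerSL ℝ b).hasFDerivAt
  refine (((h1.const_mul (1 / 2)).add h2).add_const c).congr_fderiv ?_
  ext y
  have h3 := inner_act_left hB x y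
  simp [actL_apply, ← h3]
  rw [real_inner_comm y (act B x)]
  ring

theorem gradient_of_quadratic {f : E d → ℝ} {B : Matrix (Fin d) (Fin d) ℝ} {b : E d} {c : ℝ}
    (hB : B.IsSymm) (hf : ∀ x, f x = 1 / 2 * quadForm B x + inner ℝ b x + c) (x : E d) :
    gradient f x = act B x + b := by
  rw [funext hf]
  exact (hasGradientAt_quadratic hB b c x).gradient

theorem contDiff_quadratic (B : Matrix (Fin d) (Fin d) ℝ) (b : E d) (c : ℝ) :
    ContDiff ℝ ∞ fun x : E d => 1 / 2 * quadForm B x + inner ℝ b x + c := by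
  simp only [← inner_act_eq_quadForm, ← actL_apply]
  exact ((contDiff_const.mul (contDiff_id.inner ℝ (actL B).contDiff)).add
    (contDiff_const.inner ℝ contDiff_id)).add contDiff_const

theorem sum_coord_smul_single (v : E d) : ∑ i, v i • EuclideanSpace.single i (1 : ℝ) = v := by
  ext j
  simp [Pi.single_apply]

theorem divergence_smul_affine {ρ : E d → ℝ} {x : E d} (hρ : DifferentiableAt ℝ ρ x)
    (M : Matrix (Fin d) (Fin d) ℝ) (w : E d) :
    divergence (fun y => ρ y • (act M y + w)) x =
      fderiv ℝ ρ x (act M x + w) + ρ x * M.trace := by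
  have hi : ∀ i, fderiv ℝ (fun y => (ρ y • (act M y + w)) i) x (EuclideanSpace.single i 1) =
      (act M x + w) i * fderiv ℝ ρ x (EuclideanSpace.single i 1) + ρ x * M i i := fun i => by
    have h1 : HasFDerivAt (fun y => (act M y + w) i)
        ((EuclideanSpace.proj i : E d →L[ℝ] ℝ).comp (actL M)) x :=
      (EuclideanSpace.proj i : E d →L[ℝ] ℝ).hasFDerivAt.comp x (hasFDerivAt_act_affine M w x)
    have h2 := hρ.hasFDerivAt.mul h1
    have h3 : (fun y => (ρ y • (act M y + w)) i) = ρ * fun y => (act M y + w) i := by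
      ext y; simp [mul_add]
    rw [h3, h2.fderiv]
    simp only [add_apply, smul_apply,
      ContinuousLinearMap.comp_apply, actL_apply, smul_eq_mul]
    have h4 : (EuclideanSpace.proj i : E d →L[ℝ] ℝ) (act M (EuclideanSpace.single i 1)) = M i i := by
      change act M (EuclideanSpace.single i 1) i = M i i
      rw [act_apply]
      simp
    rw [h4, add_comm]
  rw [divergence, Finset.sum_congr rfl fun i _ => hi i, Finset.sum_add_distrib, Matrix.trace,
    Finset.mul_sum]
  congr 1
  conv_rhs => rw [← sum_coord_smul_single (act M x + w), map_sum]
  refine Finset.sum_congr rfl fun i _ => ?_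
  rw [map_smul, smul_eq_mul]

/-- The matrix of the affine velocity field that belongs to a quadratic potential. -/
def velMat (lam : ℝ) (C B : Matrix (Fin d) (Fin d) ℝ) : Matrix (Fin d) (Fin d) ℝ :=
  (C + lam • 1) * B

/-- The constant part of the affine velocity field that belongs to a quadratic potential. -/
def velVec (lam : ℝ) (C : Matrix (Fin d) (Fin d) ℝ) (b : E d) : E d :=
  act (C + lam • 1) b

variable {f : E d → ℝ} {B : Matrix (Fin d) (Fin d) ℝ} {b : E d} {c : ℝ} {lam : ℝ}

theorem velocity_quadratic (hB : B.IsSymm)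
    (hf : ∀ x, f x = 1 / 2 * quadForm B x + inner ℝ b x + c) (ρ : E d → ℝ) (x : E d) :
    velocity lam ρ f x = act (velMat lam (cov ρ) B) x + velVec lam (cov ρ) b := by
  rw [velocity, gradient_of_quadratic hB hf, act_add, velMat, velVec, act_mul]

theorem inertia_quadratic (hB : B.IsSymm)
    (hf : ∀ x, f x = 1 / 2 * quadForm B x + inner ℝ b x + c) {ρ : E d → ℝ} {x : E d}
    (hρ : DifferentiableAt ℝ ρ x) :
    inertia lam ρ f x =
      -(fderiv ℝ ρ x (act (velMat lam (cov ρ) B) x + velVec lam (cov ρ) b) +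
        ρ x * (velMat lam (cov ρ) B).trace) := by
  rw [inertia, ← divergence_smul_affine hρ]
  congr 2
  ext y
  rw [velocity_quadratic hB hf]

/-- Along the characteristics the density solves a scalar linear equation. -/
theorem IsDualGeodesic.hasDerivWithinAt_characteristic {ρ : ℝ → E d → ℝ} (hB : B.IsSymm)
    (hf : ∀ x, f x = 1 / 2 * quadForm B x + inner ℝ b x + c) (h : IsDualGeodesic lam f ρ)
    {X : ℝ → E d} {t : ℝ} (ht : t ∈ Icc (0 : ℝ) 1)
    (hX : HasDerivWithinAt X (act (velMat lam (cov (ρ t)) B) (X t) + velVec lam (cov (ρ t)) b)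
      (Icc (0 : ℝ) 1) t) :
    HasDerivWithinAt (fun s => ρ s (X s)) (-(ρ t (X t) * (velMat lam (cov (ρ t)) B).trace))
      (Icc (0 : ℝ) 1) t := by
  set F : ℝ × E d → ℝ := fun p => ρ p.1 p.2 with hF
  set v := act (velMat lam (cov (ρ t)) B) (X t) + velVec lam (cov (ρ t)) b with hv
  have hFd : HasFDerivWithinAt F (fderivWithin ℝ F (Icc (0 : ℝ) 1 ×ˢ univ) (t, X t))
      (Icc (0 : ℝ) 1 ×ˢ univ) (t, X t) :=
    ((h.smooth.differentiableOn (by simp)) (t, X t) ⟨ht, mem_univ _⟩).hasFDerivWithinAt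
  set F' := fderivWithin ℝ F (Icc (0 : ℝ) 1 ×ˢ univ) (t, X t)
  have hu : UniqueDiffWithinAt ℝ (Icc (0 : ℝ) 1) t := uniqueDiffOn_Icc zero_lt_one t ht
  have hmaps : ∀ Y : ℝ → E d, MapsTo (fun s => (s, Y s)) (Icc (0 : ℝ) 1)
      (Icc (0 : ℝ) 1 ×ˢ univ) := fun Y s hs => ⟨hs, mem_univ _⟩
  have hp1 : HasDerivWithinAt (fun s => (s, X s)) ((1 : ℝ), v) (Icc (0 : ℝ) 1) t :=
    (hasDerivAt_id' t).hasDerivWithinAt.prodMk hX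
  have hp2 : HasDerivWithinAt (fun s => (s, X t)) ((1 : ℝ), (0 : E d)) (Icc (0 : ℝ) 1) t :=
    (hasDerivAt_id' t).hasDerivWithinAt.prodMk (hasDerivWithinAt_const t _ (X t))
  have h1 : HasDerivWithinAt (F ∘ fun s => (s, X s)) (F' (1, v)) (Icc (0 : ℝ) 1) t :=
    HasFDerivWithinAt.comp_hasDerivWithinAt t hFd hp1 (hmaps X)
  have h2 : HasDerivWithinAt (F ∘ fun s => (s, X t)) (F' (1, 0)) (Icc (0 : ℝ) 1) t :=
    HasFDerivWithinAt.comp_hasDerivWithinAt t hFd hp2 (hmaps fun _ => X t)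
  have h3 : HasFDerivAt (fun x => F (t, x)) (F'.comp (ContinuousLinearMap.inr ℝ ℝ (E d))) (X t) := by
    rw [← hasFDerivWithinAt_univ]
    exact hFd.comp (X t) ((hasFDerivAt_prodMk_right t (X t)).hasFDerivWithinAt)
      fun x _ => ⟨ht, mem_univ _⟩
  -- The time derivative at a fixed point is given by the geodesic equation. At the ends of the
  -- interval it is one-sided, hence the uniqueness of derivatives within `Icc 0 1`.
  have e2 : F' (1, 0) = inertia lam (ρ t) f (X t) := hu.eq_deriv _ h2 (h.geodesic t ht (X t))
  have e3 : fderiv ℝ (ρ t) (X t) = F'.comp (ContinuousLinearMap.inr ℝ ℝ (E d)) := h3.fderiv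
  refine h1.congr_deriv ?_
  have e4 : F' (1, v) = F' (1, 0) + F' (0, v) := by rw [← map_add]; simp
  rw [e4, e2, inertia_quadratic hB hf ((h.density t ht).smooth.differentiable (by simp) _), e3]
  simp only [ContinuousLinearMap.comp_apply, ContinuousLinearMap.inr_apply]
  ring

end Continuity

/-! ### The affine flow that transports a dual geodesic. -/

section Flow

open scoped Matrix.Norms.Operator

variable {d : ℕ} {f : E d → ℝ} {B : Matrix (Fin d) (Fin d) ℝ} {b : E d} {c : ℝ} {lam : ℝ}

/-- A dual geodesic with a quadratic potential is transported by an affine flow. -/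
theorem IsDualGeodesic.exists_flow {ρ : ℝ → E d → ℝ} (hB : B.IsSymm)
    (hf : ∀ x, f x = 1 / 2 * quadForm B x + inner ℝ b x + c) (h : IsDualGeodesic lam f ρ) :
    ∃ (A N : ℝ → Matrix (Fin d) (Fin d) ℝ) (a : ℝ → E d), A 0 = 1 ∧ N 0 = 1 ∧ a 0 = 0 ∧
      (∀ t ∈ Icc (0 : ℝ) 1, HasDerivWithinAt A (velMat lam (cov (ρ t)) B * A t) (Icc 0 1) t) ∧
      (∀ t ∈ Icc (0 : ℝ) 1, HasDerivWithinAt N (-(N t * velMat lam (cov (ρ t)) B)) (Icc 0 1) t) ∧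
      (∀ t ∈ Icc (0 : ℝ) 1, HasDerivWithinAt a
        (act (velMat lam (cov (ρ t)) B) (a t) + velVec lam (cov (ρ t)) b) (Icc 0 1) t) ∧
      (∀ t, N t * A t = 1) ∧
      ∀ t ∈ Icc (0 : ℝ) 1, ∀ y, ρ t (act (A t) y + a t) * |(A t).det| = ρ 0 y := by
  have h01 : (0 : ℝ) ≤ 1 := zero_le_one
  -- Clamping time to [0,1] extends the coefficients to bounded continuous functions on the whole
  -- line, as `exists_resolvent` requires.
  set P : ℝ → ℝ := fun t => projIcc 0 1 h01 t with hPdef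
  have hPm : ∀ t, P t ∈ Icc (0 : ℝ) 1 := fun t => (projIcc 0 1 h01 t).2
  have hP : ∀ t ∈ Icc (0 : ℝ) 1, P t = t := fun t ht => by simp [hPdef, projIcc_of_mem h01 ht]
  have hPc : Continuous P := continuous_subtype_val.comp continuous_projIcc
  have hCc : Continuous fun t => cov (ρ (P t)) := h.cov_continuous.comp_continuous hPc hPm
  set M : ℝ → Matrix (Fin d) (Fin d) ℝ := fun t => velMat lam (cov (ρ (P t))) B with hMdef
  have hM : Continuous M := (hCc.add continuous_const).mul continuous_const
  set w : ℝ → E d := fun t => velVec lam (cov (ρ (P t))) b with hwdef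
  have hw : Continuous w := (actL.continuous.comp (hCc.add continuous_const)).clm_apply
    continuous_const
  obtain ⟨K, hK⟩ : ∃ K, ∀ t, ‖M t‖ ≤ K := by
    obtain ⟨K, hK⟩ := isCompact_Icc.exists_bound_of_continuousOn (s := Icc (0 : ℝ) 1) hM.continuousOn
    refine ⟨K, fun t => ?_⟩
    have h2 := hK (P t) (hPm t)
    have : M (P t) = M t := by simp only [hMdef, hP _ (hPm t)]
    rwa [this] at h2
  obtain ⟨A, N, hA0, hN0, hA, hN, hNA⟩ := exists_resolvent hM hK
  have hAN : ∀ t, A t * N t = 1 := fun t => mul_eq_one_comm.mp (hNA t)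
  have hNc : Continuous N := continuous_iff_continuousAt.mpr fun t => (hN t).continuousAt
  have hNw : Continuous fun s => act (N s) (w s) := (actL.continuous.comp hNc).clm_apply hw
  -- Variation of constants: the translation part is a = A ∫ N w.
  set z : ℝ → E d := fun t => ∫ s in (0 : ℝ)..t, act (N s) (w s) with hzdef
  have hz : ∀ t, HasDerivAt z (act (N t) (w t)) t := fun t =>
    intervalIntegral.integral_hasDerivAt_right (hNw.intervalIntegrable 0 t)
      hNw.stronglyMeasurable.stronglyMeasurableAtFilter hNw.continuousAt
  have hactA : ∀ {y : ℝ → E d} {y' : E d} {t : ℝ}, HasDerivAt y y' t →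
      HasDerivAt (fun s => act (A s) (y s)) (act (M t) (act (A t) (y t)) + act (A t) y') t :=
    fun {y y' t} hy => by
      have h1 : HasDerivAt (fun s => actL (A s)) (actL (M t * A t)) t :=
        actL.hasFDerivAt.comp_hasDerivAt t (hA t)
      have h2 := h1.clm_apply hy
      simp only [actL_apply, act_mul] at h2
      exact h2
  set a : ℝ → E d := fun t => act (A t) (z t) with hadef
  have ha : ∀ t, HasDerivAt a (act (M t) (a t) + w t) t := fun t => by
    refine (hactA (hz t)).congr_deriv ?_
    rw [← act_mul (A t) (N t), hAN, act_one]
  have hX : ∀ (y : E d) t, HasDerivAt (fun s => act (A s) y + a s)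
      (act (M t) (act (A t) y + a t) + w t) t := fun y t => by
    refine ((hactA (hasDerivAt_const t y)).add (ha t)).congr_deriv ?_
    have : act (A t) 0 = 0 := map_zero (actL (A t))
    rw [this, act_add]; abel
  -- J is the integrating factor for the density along a characteristic, where ρ' = -ρ tr M.
  set J : ℝ → ℝ := fun t => Real.exp (∫ s in (0 : ℝ)..t, (M s).trace) with hJdef
  have htr : Continuous fun s => (M s).trace := hM.matrix_trace
  have hJ : ∀ t, HasDerivAt J (J t * (M t).trace) t := fun t =>
    (intervalIntegral.integral_hasDerivAt_right (htr.intervalIntegrable 0 t)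
      htr.stronglyMeasurable.stronglyMeasurableAtFilter htr.continuousAt).exp
  have ha0 : a 0 = 0 := by
    simp only [hadef, hzdef, intervalIntegral.integral_same]
    exact map_zero (actL (A 0))
  have hconst : ∀ t ∈ Icc (0 : ℝ) 1, ∀ y, ρ t (act (A t) y + a t) * J t = ρ 0 y := by
    intro t ht y
    have hd : ∀ s ∈ Icc (0 : ℝ) 1,
        HasDerivWithinAt (fun s => ρ s (act (A s) y + a s) * J s) 0 (Icc 0 1) s := fun s hs => by
      have h1 := h.hasDerivWithinAt_characteristic hB hf (X := fun s => act (A s) y + a s) hs (by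
        have := (hX y s).hasDerivWithinAt (s := Icc (0 : ℝ) 1)
        simpa only [hMdef, hwdef, hP s hs] using this)
      refine (h1.mul (hJ s).hasDerivWithinAt).congr_deriv ?_
      simp only [hMdef, hP s hs]
      ring
    have := constant_of_derivWithin_zero (fun s hs => (hd s hs).differentiableWithinAt)
      (fun s hs => (hd s (Ico_subset_Icc_self hs)).derivWithin
        (uniqueDiffOn_Icc zero_lt_one s (Ico_subset_Icc_self hs))) t ht
    rw [this, hA0, ha0, act_one, add_zero]
    simp [hJdef]
  refine ⟨A, N, a, hA0, hN0, ha0, fun t ht => ?_, fun t ht => ?_, fun t ht => ?_, hNA,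
    fun t ht y => ?_⟩
  · have := (hA t).hasDerivWithinAt (s := Icc (0 : ℝ) 1)
    simp only [hMdef, hP t ht] at this
    exact this
  · have := (hN t).hasDerivWithinAt (s := Icc (0 : ℝ) 1)
    simp only [hMdef, hP t ht] at this
    exact this
  · simpa only [hMdef, hwdef, hP t ht] using (ha t).hasDerivWithinAt (s := Icc (0 : ℝ) 1)
  · have hJ0 : J t ≠ 0 := (Real.exp_pos _).ne'
    have hdet : (A t).det ≠ 0 := fun h0 => by
      have := congrArg Matrix.det (hNA t)
      rw [Matrix.det_mul, h0, mul_zero, Matrix.det_one] at this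
      exact zero_ne_one this
    -- That |det A| = J follows from conservation of mass instead of Liouville's formula: both
    -- densities have integral 1, and the ratio |det A|/J does not depend on y.
    have h1 : (1 : ℝ) = |(A t).det| / J t := by
      calc (1 : ℝ) = ∫ x, ρ t x := (h.density t ht).integral_eq_one.symm
        _ = ∫ y, |(A t).det| * ρ t (act (A t) y + a t) := integral_eq_comp_affine hdet (a t) _
        _ = ∫ y, |(A t).det| / J t * ρ 0 y := by
          congr 1; ext y
          rw [← hconst t ht y]; field_simp
        _ = _ := by
          rw [integral_const_mul, (h.density 0 (by simp)).integral_eq_one, mul_one]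
    have h2 : |(A t).det| = J t := by field_simp at h1; exact h1.symm
    rw [h2, hconst t ht y]

end Flow

/-! ### The scalar equations for variance and mean in one coordinate -/

section Scalar

/-- `c` and `n` are the variance and the mean, in one coordinate, of a dual geodesic whose potential
is `½ β x² + b x` there. -/
structure IsScalarGeodesic (lam β b : ℝ) (c n : ℝ → ℝ) : Prop where
  pos : ∀ t ∈ Icc (0 : ℝ) 1, 0 < c t
  var : ∀ t ∈ Icc (0 : ℝ) 1, HasDerivWithinAt c (2 * β * (c t + lam) * c t) (Icc 0 1) t
  mean : ∀ t ∈ Icc (0 : ℝ) 1, HasDerivWithinAt n ((c t + lam) * (β * n t + b)) (Icc 0 1) t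

variable {lam β b : ℝ} {c n : ℝ → ℝ}

theorem eq_of_hasDerivWithinAt_zero {F : ℝ → ℝ}
    (h : ∀ t ∈ Icc (0 : ℝ) 1, HasDerivWithinAt F 0 (Icc 0 1) t) {t : ℝ} (ht : t ∈ Icc (0 : ℝ) 1) :
    F t = F 0 :=
  constant_of_derivWithin_zero (fun s hs => (h s hs).differentiableWithinAt)
    (fun s hs => (h s (Ico_subset_Icc_self hs)).derivWithin
      (uniqueDiffOn_Icc zero_lt_one s (Ico_subset_Icc_self hs))) t ht

theorem integral_of_hasDerivWithinAt {F F' : ℝ → ℝ} (hc : ContinuousOn F' (Icc 0 1))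
    (h : ∀ t ∈ Icc (0 : ℝ) 1, HasDerivWithinAt F (F' t) (Icc 0 1) t) :
    ∫ t in (0 : ℝ)..1, F' t = F 1 - F 0 :=
  intervalIntegral.integral_eq_sub_of_hasDerivAt_of_le zero_le_one
    (fun t ht => (h t ht).continuousWithinAt)
    (fun t ht => (h t (Ioo_subset_Icc_self ht)).hasDerivAt (Icc_mem_nhds ht.1 ht.2))
    (by rw [← uIcc_of_le (zero_le_one' ℝ)] at hc; exact hc.intervalIntegrable)

theorem IsScalarGeodesic.continuousOn_var (h : IsScalarGeodesic lam β b c n) :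
    ContinuousOn c (Icc 0 1) := fun t ht => (h.var t ht).continuousWithinAt

theorem IsScalarGeodesic.continuousOn_mean (h : IsScalarGeodesic lam β b c n) :
    ContinuousOn n (Icc 0 1) := fun t ht => (h.mean t ht).continuousWithinAt

/-- The function log(c/(c + λ)) has constant slope 2λβ, so the end variances determine β. -/
theorem IsScalarGeodesic.log_eq (h : IsScalarGeodesic lam β b c n) (hlam : 0 < lam) :
    Real.log (c 1 / c 0) + Real.log ((c 0 + lam) / (c 1 + lam)) = 2 * lam * β := by
  have hd : ∀ t ∈ Icc (0 : ℝ) 1, HasDerivWithinAt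
      (fun t => Real.log (c t) - Real.log (c t + lam) - 2 * lam * β * t) 0 (Icc 0 1) t :=
    fun t ht => by
      have hc := h.pos t ht
      have h1 := (h.var t ht).log hc.ne'
      have h2 := ((h.var t ht).add_const lam).log (by positivity)
      refine ((h1.sub h2).sub ((hasDerivAt_id' t).hasDerivWithinAt.const_mul (2 * lam * β))).congr_deriv ?_
      field_simp
      ring
  have := eq_of_hasDerivWithinAt_zero hd (right_mem_Icc.mpr zero_le_one)
  simp only [mul_one, mul_zero, sub_zero] at this
  have h0 := h.pos 0 (by simp)
  have h1 := h.pos 1 (by simp)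
  rw [Real.log_div h1.ne' h0.ne', Real.log_div (by positivity) (by positivity)]
  linarith

/-- An explicit primitive is tβc/2 - ¼ log(c + λ): the term βc/2 from differentiating t cancels
against the logarithm. Then β is eliminated by `IsScalarGeodesic.log_eq`. -/
theorem IsScalarGeodesic.integral_var (h : IsScalarGeodesic lam β b c n) (hlam : 0 < lam) :
    ∫ t in (0 : ℝ)..1, t * (β ^ 2 * (c t + lam) * c t) = xiScalar lam (c 0) (c 1) / (4 * lam) := by
  have hcc := h.continuousOn_var
  have h0 := h.pos 0 (by simp)
  have h1 := h.pos 1 (by simp)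
  have hd : ∀ t ∈ Icc (0 : ℝ) 1, HasDerivWithinAt
      (fun t => t * (β / 2 * c t) - 1 / 4 * Real.log (c t + lam))
      (t * (β ^ 2 * (c t + lam) * c t)) (Icc 0 1) t := fun t ht => by
    have hc := h.pos t ht
    have h2 := ((h.var t ht).add_const lam).log (by positivity)
    refine (((hasDerivAt_id' t).hasDerivWithinAt.mul ((h.var t ht).const_mul (β / 2))).sub
      (h2.const_mul (1 / 4))).congr_deriv ?_
    field_simp
    ring
  rw [integral_of_hasDerivWithinAt (by fun_prop) hd]
  have hlog := h.log_eq hlam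
  have hl2 := Real.log_div (x := c 0 + lam) (y := c 1 + lam) (by positivity) (by positivity)
  have hβ : β = (Real.log (c 1 / c 0) + Real.log ((c 0 + lam) / (c 1 + lam))) / (2 * lam) := by
    rw [hlog]; field_simp
  rw [xiScalar]
  have e : (1 : ℝ) * (β / 2 * c 1) - 1 / 4 * Real.log (c 1 + lam) -
      (0 * (β / 2 * c 0) - 1 / 4 * Real.log (c 0 + lam)) =
      β * c 1 / 2 + 1 / 4 * Real.log ((c 0 + lam) / (c 1 + lam)) := by rw [hl2]; ring
  rw [e, hβ]
  field_simp
  ring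

theorem IsScalarGeodesic.integral_action (h : IsScalarGeodesic lam β b c n) (hlam : 0 < lam) :
    ∫ t in (0 : ℝ)..1, t * (β ^ 2 * (c t + lam) * c t + (c t + lam) * (β * n t + b) ^ 2) =
      coordValue lam (c 0) (c 1) (n 1 - n 0) := by
  have hcc := h.continuousOn_var
  have hnc := h.continuousOn_mean
  have h0 := h.pos 0 (by simp)
  have h1 := h.pos 1 (by simp)
  have hI : ∀ F : ℝ → ℝ, ContinuousOn F (Icc 0 1) → IntervalIntegrable F volume 0 1 := fun F hF => by
    rw [← uIcc_of_le (zero_le_one' ℝ)] at hF; exact hF.intervalIntegrable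
  simp only [mul_add (_ : ℝ) (β ^ 2 * _ * _)]
  rw [intervalIntegral.integral_add (hI _ (by fun_prop)) (hI _ (by fun_prop)),
    h.integral_var hlam, coordValue]
  congr 1
  have hlog := h.log_eq hlam
  -- β vanishes exactly when the end variances agree, so this split matches the branches of
  -- `coordValue`.
  rcases eq_or_ne β 0 with rfl | hβ
  · have hconst : ∀ t ∈ Icc (0 : ℝ) 1, c t = c 0 := fun t ht =>
      eq_of_hasDerivWithinAt_zero (fun s hs => (h.var s hs).congr_deriv (by ring)) ht
    have hpq : c 1 = c 0 := hconst 1 (by simp)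
    rw [if_pos hpq.symm]
    have hn : ∀ t ∈ Icc (0 : ℝ) 1, HasDerivWithinAt (fun t => n t - (c 0 + lam) * b * t) 0
        (Icc 0 1) t := fun t ht => by
      refine ((h.mean t ht).sub ((hasDerivAt_id' t).hasDerivWithinAt.const_mul _)).congr_deriv ?_
      rw [hconst t ht]; ring
    have hn1 := eq_of_hasDerivWithinAt_zero hn (right_mem_Icc.mpr zero_le_one)
    have hδ : n 1 - n 0 = (c 0 + lam) * b := by linarith
    have hintegral : ∫ t in (0 : ℝ)..1, t * ((c t + lam) * (0 * n t + b) ^ 2) =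
        ∫ t in (0 : ℝ)..1, t * ((c 0 + lam) * b ^ 2) := by
      refine intervalIntegral.integral_congr fun t ht => ?_
      rw [uIcc_of_le zero_le_one] at ht
      simp only [hconst t ht]; ring
    rw [hintegral, intervalIntegral.integral_mul_const, integral_id, hδ]
    field_simp
    ring
  · have hpq : c 0 ≠ c 1 := fun he => by
      rw [he, div_self h1.ne', div_self (by positivity), Real.log_one] at hlog
      have : (2 * lam) * β ≠ 0 := mul_ne_zero (by positivity) hβ
      exact this (by linarith)
    rw [if_neg hpq]
    set u : ℝ → ℝ := fun t => β * n t + b with hu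
    -- Both u = βn + b and √c have logarithmic rate β(c + λ). Thus u = k√c, which makes the mean
    -- term (k/β)² times the variance term and gives δ = (k/β)(√c(1) - √c(0)).
    have hk : ∀ t ∈ Icc (0 : ℝ) 1, HasDerivWithinAt (fun t => u t / √(c t)) 0 (Icc 0 1) t :=
      fun t ht => by
        have hc := h.pos t ht
        have hsq : √(c t) ≠ 0 := (Real.sqrt_pos.mpr hc).ne'
        refine ((((h.mean t ht).const_mul β).add_const b).div ((h.var t ht).sqrt hc.ne')
          hsq).congr_deriv ?_
        field_simp
        rw [Real.sq_sqrt hc.le]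
        ring
    have hku : ∀ t ∈ Icc (0 : ℝ) 1, u t = u 0 / √(c 0) * √(c t) := fun t ht => by
      have h2 : u t / √(c t) = u 0 / √(c 0) := eq_of_hasDerivWithinAt_zero hk ht
      rw [← h2, div_mul_cancel₀ _ (Real.sqrt_pos.mpr (h.pos t ht)).ne']
    set k := u 0 / √(c 0)
    have hs : √(c 1) - √(c 0) ≠ 0 := fun he =>
      hpq ((Real.sqrt_inj h0.le h1.le).mp (sub_eq_zero.mp he).symm)
    have hδ : β * (n 1 - n 0) = k * (√(c 1) - √(c 0)) := by
      have e1 := hku 1 (by simp)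
      have e0 := hku 0 (by simp)
      simp only [hu] at e1 e0
      linear_combination e1 - e0
    have hintegral : ∫ t in (0 : ℝ)..1, t * ((c t + lam) * (β * n t + b) ^ 2) =
        ∫ t in (0 : ℝ)..1, (k / β) ^ 2 * (t * (β ^ 2 * (c t + lam) * c t)) := by
      refine intervalIntegral.integral_congr fun t ht => ?_
      rw [uIcc_of_le zero_le_one] at ht
      have e := hku t ht
      simp only [hu] at e
      rw [e, mul_pow, Real.sq_sqrt (h.pos t ht).le]
      field_simp
    rw [hintegral, intervalIntegral.integral_const_mul, h.integral_var hlam]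
    have : n 1 - n 0 = k / β * (√(c 1) - √(c 0)) := by
      field_simp; linarith
    rw [this]
    field_simp

end Scalar

/-! ### Uniqueness of the quadratic part of the potential -/

section Riccati

variable {d : ℕ}

theorem exp_odiag {U : Matrix (Fin d) (Fin d) ℝ} (hU : U * Uᵀ = 1) (a : Fin d → ℝ) :
    NormedSpace.exp (odiag U a) = odiag U fun i => Real.exp (a i) := by
  have hinv : U⁻¹ = Uᵀ := Matrix.inv_eq_right_inv hU
  have hunit : IsUnit U := IsUnit.of_mul_eq_one _ hU
  rw [odiag, ← hinv, Matrix.exp_conj _ _ hunit, Matrix.exp_diagonal, hinv, odiag]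
  congr 3
  ext i
  rw [Pi.coe_exp, Real.exp_eq_exp_ℝ]

theorem cfc_log_exp {B : Matrix (Fin d) (Fin d) ℝ} (hB : B.IsSymm) :
    cfc Real.log (NormedSpace.exp B) = B := by
  obtain ⟨V, a, hV, hV', rfl⟩ := exists_eq_odiag (T := B)
    (by rw [Matrix.IsHermitian, Matrix.conjTranspose_eq_transpose_of_trivial, hB.eq])
  rw [exp_odiag hV, cfc_odiag hV hV']
  simp

theorem cfc_sqrt_mul_self {A : Matrix (Fin d) (Fin d) ℝ} (hA : A.PosDef) :
    cfc Real.sqrt (A * A) = A := by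
  obtain ⟨V, a, hV, hV', rfl⟩ := exists_eq_odiag hA.isHermitian
  rw [odiag_mul hV', cfc_odiag hV hV']
  congr 1
  ext i
  exact Real.sqrt_mul_self (odiag_pos_of_posDef hV' hA i).le

theorem posDef_odiag {U : Matrix (Fin d) (Fin d) ℝ} (hU : U * Uᵀ = 1) {a : Fin d → ℝ}
    (ha : ∀ i, 0 < a i) : (odiag U a).PosDef := by
  have h1 : (Matrix.diagonal a).PosDef := Matrix.PosDef.diagonal ha
  have h2 := h1.conjTranspose_mul_mul_same (B := Uᵀ) (Matrix.mulVec_injective_of_isUnit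
    (IsUnit.of_mul_eq_one U (mul_eq_one_comm.mp hU)))
  rwa [Matrix.conjTranspose_eq_transpose_of_trivial, Matrix.transpose_transpose] at h2

/-- The equation `e^B Z₁ e^B = Z₀` has only one symmetric solution `B` for commuting symmetric
`Z₀` and positive definite `Z₁`, and it commutes with them. -/
theorem eq_odiag_of_exp_mul_exp {U : Matrix (Fin d) (Fin d) ℝ} (hU : U * Uᵀ = 1) (hU' : Uᵀ * U = 1)
    {z₀ z₁ : Fin d → ℝ} (h₁ : ∀ i, 0 < z₁ i) {B : Matrix (Fin d) (Fin d) ℝ}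
    (hB : B.IsSymm)
    (h : NormedSpace.exp B * odiag U z₁ * NormedSpace.exp B = odiag U z₀) :
    ∃ β, B = odiag U β := by
  set R := odiag U fun i => √(z₁ i) with hR
  set G := NormedSpace.exp B with hG
  have hs : ∀ i, 0 < √(z₁ i) := fun i => Real.sqrt_pos.mpr (h₁ i)
  have hRR : R * R = odiag U z₁ := by
    rw [hR, odiag_mul hU']; congr 1; ext i; exact Real.mul_self_sqrt (h₁ i).le
  have hGpos : G.PosDef := by
    obtain ⟨V, a, hV, hV', rfl⟩ := exists_eq_odiag (T := B)
      (by rw [Matrix.IsHermitian, Matrix.conjTranspose_eq_transpose_of_trivial, hB.eq])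
    rw [hG, exp_odiag hV]
    exact posDef_odiag hV fun i => Real.exp_pos _
  have hRinv : R * odiag U (fun i => (√(z₁ i))⁻¹) = 1 := by
    rw [hR, odiag_mul hU', ← odiag_one hU]
    congr 1; ext i; exact mul_inv_cancel₀ (hs i).ne'
  have hpos : (R * G * R).PosDef := by
    have h2 := hGpos.conjTranspose_mul_mul_same (B := R)
      (Matrix.mulVec_injective_of_isUnit (IsUnit.of_mul_eq_one _ hRinv))
    rwa [Matrix.conjTranspose_eq_transpose_of_trivial, hR, odiag_transpose] at h2
  -- With R = Z₁^{1/2} and G = e^B, the equation G Z₁ G = Z₀ becomes (RGR)² = R Z₀ R, which is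
  -- diagonal. So is its positive definite root RGR, hence also G and B = log G.
  have hsq : (R * G * R) * (R * G * R) = odiag U fun i => √(z₁ i) * z₀ i * √(z₁ i) := by
    calc _ = R * (G * (R * R) * G) * R := by simp only [mul_assoc]
      _ = _ := by rw [hRR, h, hR, odiag_mul hU', odiag_mul hU']
  have h3 := cfc_sqrt_mul_self hpos
  rw [hsq, cfc_odiag hU hU'] at h3
  set w : Fin d → ℝ := fun i => √(√(z₁ i) * z₀ i * √(z₁ i))
  set R' := odiag U fun i => (√(z₁ i))⁻¹ with hR'
  have hR'R : R' * R = 1 := mul_eq_one_comm.mp hRinv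
  have hGd : G = odiag U fun i => (√(z₁ i))⁻¹ * w i * (√(z₁ i))⁻¹ := by
    calc G = (R' * R) * G * (R * R') := by rw [hR'R, hRinv, one_mul, mul_one]
      _ = R' * (R * G * R) * R' := by simp only [mul_assoc]
      _ = _ := by rw [← h3, hR', odiag_mul hU', odiag_mul hU']
  have h4 := cfc_log_exp hB
  rw [← hG, hGd, cfc_odiag hU hU'] at h4
  exact ⟨_, h4.symm⟩

open scoped Matrix.Norms.Operator in
/-- The linear equation `Z' = -(B Z + Z B)` has the solution `e^{-tB} Z₀ e^{-tB}`. -/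
theorem exp_mul_mul_exp_const {B : Matrix (Fin d) (Fin d) ℝ} {Z : ℝ → Matrix (Fin d) (Fin d) ℝ}
    (hZ : ∀ t ∈ Icc (0 : ℝ) 1, HasDerivWithinAt Z (-(B * Z t + Z t * B)) (Icc 0 1) t) {t : ℝ}
    (ht : t ∈ Icc (0 : ℝ) 1) :
    NormedSpace.exp (t • B) * Z t * NormedSpace.exp (t • B) = Z 0 := by
  have hd : ∀ s ∈ Icc (0 : ℝ) 1, HasDerivWithinAt
      (fun s => NormedSpace.exp (s • B) * Z s * NormedSpace.exp (s • B)) 0 (Icc 0 1) s :=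
    fun s hs => by
      -- The two forms of the derivative place B next to Z on either side, so the terms cancel
      -- without any commutation.
      have h1 := (hasDerivAt_exp_smul_const (𝕂 := ℝ) B s).hasDerivWithinAt (s := Icc (0 : ℝ) 1)
      have h2 := (hasDerivAt_exp_smul_const' (𝕂 := ℝ) B s).hasDerivWithinAt (s := Icc (0 : ℝ) 1)
      refine ((h1.mul (hZ s hs)).mul h2).congr_deriv ?_
      simp only [Pi.mul_apply]
      noncomm_ring
  have := constant_of_derivWithin_zero (fun s hs => (hd s hs).differentiableWithinAt)
    (fun s hs => (hd s (Ico_subset_Icc_self hs)).derivWithin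
      (uniqueDiffOn_Icc zero_lt_one s (Ico_subset_Icc_self hs))) t ht
  rw [this]
  simp

end Riccati

/-! ### Dual geodesics with a quadratic potential between elliptic distributions -/

section Geodesics

variable {d : ℕ} {U : Matrix (Fin d) (Fin d) ℝ} {f : E d → ℝ} {B : Matrix (Fin d) (Fin d) ℝ}
  {b : E d} {c₀ : ℝ} {lam : ℝ}

theorem transpose_mul_odiag_mul_apply (hU' : Uᵀ * U = 1) (v : Fin d → ℝ) (i : Fin d) :
    (Uᵀ * odiag U v * U) i i = v i := by
  have : Uᵀ * odiag U v * U = Matrix.diagonal v := by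
    calc _ = (Uᵀ * U) * Matrix.diagonal v * (Uᵀ * U) := by simp only [odiag, mul_assoc]
      _ = _ := by rw [hU', one_mul, mul_one]
  rw [this, Matrix.diagonal_apply_eq]

theorem act_transpose_odiag (hU' : Uᵀ * U = 1) (v : Fin d → ℝ) (x : E d) (i : Fin d) :
    act Uᵀ (act (odiag U v) x) i = v i * act Uᵀ x i := by
  have : act Uᵀ (act (odiag U v) x) = act (Matrix.diagonal v) (act Uᵀ x) := by
    rw [← act_mul, ← act_mul]
    congr 1
    rw [odiag, mul_assoc U, ← mul_assoc, hU', one_mul]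
  rw [this]
  exact Matrix.mulVec_diagonal v (act Uᵀ x).ofLp i

theorem posDef_transport {p : Fin d → ℝ} (hU : U * Uᵀ = 1) (hp : ∀ i, 0 < p i)
    {A N : Matrix (Fin d) (Fin d) ℝ} (hNA : N * A = 1) : (A * odiag U p * Aᵀ).PosDef := by
  have h1 : IsUnit Aᵀ := IsUnit.of_mul_eq_one Nᵀ (by
    rw [← Matrix.transpose_mul, hNA, Matrix.transpose_one])
  have h2 := (posDef_odiag hU hp).conjTranspose_mul_mul_same (B := Aᵀ)
    (Matrix.mulVec_injective_of_isUnit h1)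
  rwa [Matrix.conjTranspose_eq_transpose_of_trivial, Matrix.transpose_transpose] at h2

theorem velMat_odiag (hU : U * Uᵀ = 1) (hU' : Uᵀ * U = 1) (c β : Fin d → ℝ) :
    velMat lam (odiag U c) (odiag U β) = odiag U fun i => (c i + lam) * β i := by
  rw [velMat, ← odiag_one hU, smul_odiag, odiag_add, odiag_mul hU']
  simp

open scoped Matrix.Norms.Operator in
theorem hasDerivWithinAt_transpose {A : ℝ → Matrix (Fin d) (Fin d) ℝ}
    {A' : Matrix (Fin d) (Fin d) ℝ} {s : Set ℝ} {t : ℝ} (h : HasDerivWithinAt A A' s t) :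
    HasDerivWithinAt (fun t => (A t)ᵀ) A'ᵀ s t :=
  (LinearMap.toContinuousLinearMap
    (Matrix.transposeLinearEquiv (Fin d) (Fin d) ℝ ℝ).toLinearMap).hasFDerivAt.comp_hasDerivWithinAt
      t h

open scoped Matrix.Norms.Operator in
/-- In an orthonormal basis in which the covariances of the end points are diagonal, a dual geodesic
with a quadratic potential is a product of scalar ones. -/
theorem IsDualGeodesic.exists_scalar {ρ : ℝ → E d → ℝ} (hU : U * Uᵀ = 1) (hU' : Uᵀ * U = 1)
    (hlam : 0 < lam) {p q : Fin d → ℝ} (hp : ∀ i, 0 < p i) (hq : ∀ i, 0 < q i) {m₀ m₁ : E d}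
    (hB : B.IsSymm) (hf : ∀ x, f x = 1 / 2 * quadForm B x + inner ℝ b x + c₀)
    (h : IsDualGeodesic lam f ρ) (h₀ : HasMoments (ρ 0) m₀ (odiag U p))
    (h₁ : HasMoments (ρ 1) m₁ (odiag U q)) :
    ∃ (β : Fin d → ℝ) (c : ℝ → Fin d → ℝ) (m : ℝ → E d), B = odiag U β ∧
      (∀ t ∈ Icc (0 : ℝ) 1, HasMoments (ρ t) (m t) (odiag U (c t))) ∧
      ∀ i, IsScalarGeodesic lam (β i) (act Uᵀ b i) (fun t => c t i) fun t => act Uᵀ (m t) i := by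
  obtain ⟨A, N, a, hA0, hN0, ha0, hA, hN, ha, hNA, hρ⟩ := h.exists_flow hB hf
  have hAN : ∀ t, A t * N t = 1 := fun t => mul_eq_one_comm.mp (hNA t)
  have hdet : ∀ t, (A t).det ≠ 0 := fun t h0 => by
    have := congrArg Matrix.det (hNA t)
    rw [Matrix.det_mul, h0, mul_zero, Matrix.det_one] at this
    exact zero_ne_one this
  set C : ℝ → Matrix (Fin d) (Fin d) ℝ := fun t => A t * odiag U p * (A t)ᵀ with hC
  set m : ℝ → E d := fun t => act (A t) m₀ + a t with hm
  have hmom : ∀ t ∈ Icc (0 : ℝ) 1, HasMoments (ρ t) (m t) (C t) := fun t ht =>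
    h₀.transport (hdet t) (hρ t ht)
  have hcov : ∀ t ∈ Icc (0 : ℝ) 1, cov (ρ t) = C t := fun t ht => (hmom t ht).cov_eq
  have hCsymm : ∀ t, (C t)ᵀ = C t := fun t => by
    simp only [hC, Matrix.transpose_mul, Matrix.transpose_transpose, odiag_transpose, mul_assoc]
  set D := odiag U fun i => (p i)⁻¹ with hD
  have hDp : D * odiag U p = 1 := by
    rw [hD, odiag_mul hU', ← odiag_one hU]
    congr 1; ext i; exact inv_mul_cancel₀ (hp i).ne'
  -- Y is the inverse of C; writing it through N gives its derivative from that of N, with no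
  -- differentiation of an inverse.
  set Y : ℝ → Matrix (Fin d) (Fin d) ℝ := fun t => (N t)ᵀ * D * N t with hY
  have hYC : ∀ t, Y t * C t = 1 := fun t => by
    calc Y t * C t = (N t)ᵀ * D * (N t * A t) * odiag U p * (A t)ᵀ := by
          simp only [hY, hC, mul_assoc]
      _ = (N t)ᵀ * (D * odiag U p) * (A t)ᵀ := by rw [hNA]; simp only [mul_one, mul_assoc]
      _ = 1 := by rw [hDp, mul_one, ← Matrix.transpose_mul, hAN, Matrix.transpose_one]
  have hCY : ∀ t, C t * Y t = 1 := fun t => mul_eq_one_comm.mp (hYC t)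
  have hM : ∀ t ∈ Icc (0 : ℝ) 1, velMat lam (cov (ρ t)) B = C t * B + lam • B := fun t ht => by
    rw [hcov t ht, velMat, add_mul, smul_mul_assoc, one_mul]
  have hMT : ∀ t ∈ Icc (0 : ℝ) 1, (velMat lam (cov (ρ t)) B)ᵀ = B * C t + lam • B := fun t ht => by
    rw [hM t ht, Matrix.transpose_add, Matrix.transpose_mul, Matrix.transpose_smul, hB.eq, hCsymm]
  -- The Riccati equation for C becomes linear in Z = 1 + λC⁻¹, with λB in the role of the constant
  -- matrix.
  have hZ : ∀ t ∈ Icc (0 : ℝ) 1, HasDerivWithinAt (fun t => 1 + lam • Y t)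
      (-((lam • B) * (1 + lam • Y t) + (1 + lam • Y t) * (lam • B))) (Icc 0 1) t := fun t ht => by
    have h1 := ((hasDerivWithinAt_transpose (hN t ht)).mul_const D).mul (hN t ht)
    refine ((h1.const_smul lam).const_add 1).congr_deriv ?_
    have e1 : (-(N t * velMat lam (cov (ρ t)) B))ᵀ * D * N t =
        -(B + lam • (B * Y t)) := by
      rw [Matrix.transpose_neg, Matrix.transpose_mul, hMT t ht, neg_mul, neg_mul]
      congr 1
      calc (B * C t + lam • B) * (N t)ᵀ * D * N t = (B * C t + lam • B) * Y t := by
            simp only [hY, mul_assoc]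
        _ = _ := by rw [add_mul, mul_assoc, hCY, mul_one, smul_mul_assoc]
    have e2 : (N t)ᵀ * D * -(N t * velMat lam (cov (ρ t)) B) = -(B + lam • (Y t * B)) := by
      rw [hM t ht, mul_neg]
      congr 1
      calc (N t)ᵀ * D * (N t * (C t * B + lam • B)) = Y t * (C t * B + lam • B) := by
            simp only [hY, mul_assoc]
        _ = _ := by rw [mul_add, ← mul_assoc, hYC, one_mul, mul_smul_comm]
    rw [e1, e2]
    simp only [mul_add, add_mul, mul_one, one_mul, smul_mul_assoc, mul_smul_comm, smul_add,
      smul_neg]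
    abel
  have hexp := fun t ht => exp_mul_mul_exp_const hZ (t := t) ht
  have hYinv : ∀ {t} {v : Fin d → ℝ}, (∀ i, 0 < v i) → C t = odiag U v →
      1 + lam • Y t = odiag U fun i => 1 + lam * (v i)⁻¹ := fun {t v} hv hCv => by
    have hYt : Y t = odiag U fun i => (v i)⁻¹ := by
      rw [← odiag_inv hU hU' (fun i => (hv i).ne'), ← hCv]
      exact (Matrix.inv_eq_left_inv (hYC t)).symm
    rw [hYt, smul_odiag, ← odiag_one hU, odiag_add]
  have hC0 : C 0 = odiag U p := by simp only [hC, hA0]; simp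
  have hC1 : C 1 = odiag U q := by rw [← hcov 1 (by simp), h₁.cov_eq]
  have hz : ∀ v : Fin d → ℝ, (∀ i, 0 < v i) → ∀ i, 0 < 1 + lam * (v i)⁻¹ := fun v hv i => by
    have := hv i; positivity
  obtain ⟨β', hβ'⟩ : ∃ β', lam • B = odiag U β' := by
    have h2 := hexp 1 (by simp)
    rw [one_smul, hYinv hp hC0, hYinv hq hC1] at h2
    exact eq_odiag_of_exp_mul_exp hU hU' (hz q hq)
      (by rw [Matrix.IsSymm, Matrix.transpose_smul, hB.eq]) h2
  have hBd : B = odiag U fun i => lam⁻¹ * β' i := by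
    rw [← smul_odiag, ← hβ', smul_smul, inv_mul_cancel₀ hlam.ne', one_smul]
  -- Time 1 has shown that B is diagonal. Now e^{tλB} is diagonal for each t, and conjugating Z(0)
  -- back shows the same for Z(t), hence for C(t).
  have hdiag : ∀ t ∈ Icc (0 : ℝ) 1, ∃ v, C t = odiag U v := fun t ht => by
    have h2 := hexp t ht
    rw [hβ', smul_odiag, exp_odiag hU, hYinv hp hC0] at h2
    set e := odiag U fun i => Real.exp (t * β' i) with he
    set e' := odiag U fun i => (Real.exp (t * β' i))⁻¹ with he'
    have hee : e' * e = 1 := by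
      rw [he, he', odiag_mul hU', ← odiag_one hU]
      congr 1; ext i; exact inv_mul_cancel₀ (Real.exp_pos _).ne'
    have hee' : e * e' = 1 := mul_eq_one_comm.mp hee
    have h3 : 1 + lam • Y t = e' * (odiag U fun i => 1 + lam * (p i)⁻¹) * e' := by
      rw [← h2]
      calc 1 + lam • Y t = (e' * e) * (1 + lam • Y t) * (e * e') := by
            rw [hee, hee', one_mul, mul_one]
        _ = _ := by simp only [mul_assoc]
    have h4 : ∃ y, Y t = odiag U y := by
      rw [he', odiag_mul hU', odiag_mul hU'] at h3
      have h5 : Y t = lam⁻¹ • ((1 + lam • Y t) - 1) := by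
        rw [add_sub_cancel_left, smul_smul, inv_mul_cancel₀ hlam.ne', one_smul]
      rw [h3, ← odiag_one hU, odiag_sub, smul_odiag] at h5
      exact ⟨_, h5⟩
    obtain ⟨y, hy⟩ := h4
    have hy0 : ∀ i, y i ≠ 0 := by
      have h5 := congrArg Matrix.det (hYC t)
      rw [hy, Matrix.det_mul, odiag_det hU, Matrix.det_one] at h5
      exact fun i => Finset.prod_ne_zero_iff.mp (left_ne_zero_of_mul_eq_one h5) i (Finset.mem_univ i)
    refine ⟨fun i => (y i)⁻¹, ?_⟩
    rw [← odiag_inv hU hU' hy0, ← hy]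
    exact (Matrix.inv_eq_right_inv (hYC t)).symm
  -- The eigenvalues are read off by a fixed linear functional of C(t), so their derivatives follow
  -- from that of C.
  set c : ℝ → Fin d → ℝ := fun t i => (Uᵀ * C t * U) i i with hc
  have hCc : ∀ t ∈ Icc (0 : ℝ) 1, C t = odiag U (c t) := fun t ht => by
    obtain ⟨v, hv⟩ := hdiag t ht
    have : c t = v := by
      ext i
      simp only [hc, hv, transpose_mul_odiag_mul_apply hU']
    rw [this, hv]
  refine ⟨fun i => lam⁻¹ * β' i, c, m, hBd, fun t ht => by rw [← hCc t ht]; exact hmom t ht,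
    fun i => ⟨fun t ht => ?_, fun t ht => ?_, fun t ht => ?_⟩⟩
  · have := posDef_transport hU hp (hNA t)
    change (C t).PosDef at this
    rw [hCc t ht] at this
    exact odiag_pos_of_posDef hU' this i
  · have h1 := ((hA t ht).mul_const (odiag U p)).mul (hasDerivWithinAt_transpose (hA t ht))
    let T : Matrix (Fin d) (Fin d) ℝ →L[ℝ] ℝ := LinearMap.toContinuousLinearMap
      { toFun := fun X => (Uᵀ * X * U) i i
        map_add' := fun X Y => by simp [mul_add, add_mul]
        map_smul' := fun r X => by simp }
    have h2 := T.hasFDerivAt.comp_hasDerivWithinAt t h1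
    refine h2.congr_deriv ?_
    have e1 : velMat lam (cov (ρ t)) B * A t * odiag U p * (A t)ᵀ +
        A t * odiag U p * (velMat lam (cov (ρ t)) B * A t)ᵀ =
        odiag U fun i => 2 * (lam⁻¹ * β' i) * (c t i + lam) * c t i := by
      calc _ = velMat lam (cov (ρ t)) B * C t + C t * (velMat lam (cov (ρ t)) B)ᵀ := by
            simp only [hC, Matrix.transpose_mul, mul_assoc]
        _ = _ := by
            rw [hcov t ht, hCc t ht, hBd, velMat_odiag hU hU', odiag_transpose, odiag_mul hU',
              odiag_mul hU', odiag_add]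
            congr 1; ext i; ring
    change (Uᵀ * (velMat lam (cov (ρ t)) B * A t * odiag U p * (A t)ᵀ +
        A t * odiag U p * (velMat lam (cov (ρ t)) B * A t)ᵀ) * U) i i = _
    rw [e1, transpose_mul_odiag_mul_apply hU']
  · have h1 : HasDerivWithinAt (fun s => actL (A s)) (actL (velMat lam (cov (ρ t)) B * A t))
        (Icc 0 1) t := actL.hasFDerivAt.comp_hasDerivWithinAt t (hA t ht)
    have h2 := (h1.clm_apply (hasDerivWithinAt_const t _ m₀)).add (ha t ht)
    have h3 := ((EuclideanSpace.proj i : E d →L[ℝ] ℝ).comp (actL Uᵀ)).hasFDerivAt.comp_hasDerivWithinAt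
      t h2
    refine h3.congr_deriv ?_
    have e1 : actL (velMat lam (cov (ρ t)) B * A t) m₀ + actL (A t) 0 +
        (act (velMat lam (cov (ρ t)) B) (a t) + velVec lam (cov (ρ t)) b) =
        act (odiag U fun i => c t i + lam) (act B (m t) + b) := by
      have e2 : cov (ρ t) + lam • 1 = odiag U fun i => c t i + lam := by
        rw [hcov t ht, hCc t ht, ← odiag_one hU, smul_odiag, odiag_add]; simp
      rw [map_zero, add_zero, actL_apply, act_mul, velVec, velMat, e2, act_mul, act_mul,
        ← add_assoc, ← act_add, ← act_add, ← act_add]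
    change act Uᵀ (actL (velMat lam (cov (ρ t)) B * A t) m₀ + actL (A t) 0 +
        (act (velMat lam (cov (ρ t)) B) (a t) + velVec lam (cov (ρ t)) b)) i = _
    rw [e1, act_transpose_odiag hU', act_add]
    congr 1
    change act Uᵀ (act B (m t)) i + act Uᵀ b i = _
    rw [hBd, act_transpose_odiag hU']

/-- The integrand is the quadratic form of K = C + λI at Bx + b. Its expectation is tr(BKBC) from
the fluctuations plus the value at the mean, and both split over the coordinates. -/
theorem metricSq_odiag {ρ : E d → ℝ} (hU : U * Uᵀ = 1) (hU' : Uᵀ * U = 1) {c β : Fin d → ℝ}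
    (hc : ∀ i, 0 < c i) (hlam : 0 < lam) (hρ : ∀ x, 0 ≤ ρ x) {m : E d}
    (h : HasMoments ρ m (odiag U c))
    (hf : ∀ x, f x = 1 / 2 * quadForm (odiag U β) x + inner ℝ b x + c₀) :
    metricSq lam ρ f = ENNReal.ofReal (∑ i, (β i ^ 2 * (c i + lam) * c i +
      (c i + lam) * (β i * act Uᵀ m i + act Uᵀ b i) ^ 2)) := by
  have hK : cov ρ + lam • 1 = odiag U fun i => c i + lam := by
    rw [h.cov_eq, ← odiag_one hU, smul_odiag, odiag_add]; simp
  have hintegral : ∀ x, inner ℝ (gradient f x) (ρ x • velocity lam ρ f x) =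
      quadForm (odiag U fun i => c i + lam) (act (odiag U β) x + b) * ρ x := fun x => by
    rw [velocity, gradient_of_quadratic (odiag_transpose β) hf, real_inner_smul_right, hK,
      inner_act_eq_quadForm, mul_comm]
  obtain ⟨hi, hv⟩ := h.integral_quadForm_affine (odiag U fun i => c i + lam) (odiag U β) b
  have hnn : ∀ x, 0 ≤ quadForm (odiag U fun i => c i + lam) (act (odiag U β) x + b) * ρ x :=
    fun x => by
      refine mul_nonneg ?_ (hρ x)
      rw [quadForm_odiag]
      exact Finset.sum_nonneg fun i _ => mul_nonneg (by linarith [hc i]) (sq_nonneg _)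
  rw [metricSq]
  simp only [hintegral]
  rw [← ofReal_integral_eq_lintegral_ofReal hi (Filter.Eventually.of_forall hnn), hv,
    odiag_transpose, odiag_transpose, odiag_mul hU', odiag_mul hU', odiag_mul hU', odiag_trace hU',
    quadForm_odiag, ← Finset.sum_add_distrib]
  congr 1
  refine Finset.sum_congr rfl fun i _ => ?_
  have e : (Uᵀ *ᵥ (act (odiag U β) m + b).ofLp) i = β i * act Uᵀ m i + act Uᵀ b i := by
    change act Uᵀ (act (odiag U β) m + b) i = _
    rw [act_add, ← act_transpose_odiag hU']
    rfl
  rw [e]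
  ring

/-- All dual geodesics with a quadratic potential have the same action. -/
theorem IsDualGeodesic.action_eq {ρ : ℝ → E d → ℝ} (hU : U * Uᵀ = 1) (hU' : Uᵀ * U = 1)
    (hlam : 0 < lam) {p q : Fin d → ℝ} (hp : ∀ i, 0 < p i) (hq : ∀ i, 0 < q i) {m₀ m₁ : E d}
    (hf : IsQuadratic f)
    (h : IsDualGeodesic lam f ρ) (h₀ : HasMoments (ρ 0) m₀ (odiag U p))
    (h₁ : HasMoments (ρ 1) m₁ (odiag U q)) :
    0 ≤ ∑ i, coordValue lam (p i) (q i) (act Uᵀ (m₁ - m₀) i) ∧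
    action lam f ρ = ENNReal.ofReal (∑ i, coordValue lam (p i) (q i) (act Uᵀ (m₁ - m₀) i)) := by
  obtain ⟨B, b, c₀, hB, hf⟩ := hf
  obtain ⟨β, c, m, rfl, hmom, hs⟩ := h.exists_scalar hU hU' hlam hp hq hB hf h₀ h₁
  have hm0 : m 0 = m₀ := (hmom 0 (by simp)).mean_unique h₀
  have hm1 : m 1 = m₁ := (hmom 1 (by simp)).mean_unique h₁
  have hc0 : c 0 = p := odiag_injective hU' (by rw [← (hmom 0 (by simp)).cov_eq, h₀.cov_eq])
  have hc1 : c 1 = q := odiag_injective hU' (by rw [← (hmom 1 (by simp)).cov_eq, h₁.cov_eq])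
  set F : Fin d → ℝ → ℝ := fun i t => t * (β i ^ 2 * (c t i + lam) * c t i +
    (c t i + lam) * (β i * act Uᵀ (m t) i + act Uᵀ b i) ^ 2) with hF
  have hFc : ∀ i, ContinuousOn (F i) (Icc 0 1) := fun i => by
    have h1 := (hs i).continuousOn_var
    have h2 := (hs i).continuousOn_mean
    simp only [hF]
    fun_prop
  have hFnn : ∀ i, ∀ t ∈ Icc (0 : ℝ) 1, 0 ≤ F i t := fun i t ht => by
    have := (hs i).pos t ht
    have := ht.1
    positivity
  have hFi : ∀ i, IntervalIntegrable (F i) volume 0 1 := fun i => by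
    have := hFc i
    rw [← uIcc_of_le (zero_le_one' ℝ)] at this
    exact this.intervalIntegrable
  have hval : ∫ t in Icc (0 : ℝ) 1, ∑ i, F i t =
      ∑ i, coordValue lam (p i) (q i) (act Uᵀ (m₁ - m₀) i) := by
    rw [integral_Icc_eq_integral_Ioc, ← intervalIntegral.integral_of_le zero_le_one,
      intervalIntegral.integral_finsetSum fun i _ => hFi i]
    refine Finset.sum_congr rfl fun i _ => ?_
    rw [(hs i).integral_action hlam, hc0, hc1, hm0, hm1, act_sub]
    rfl
  have hsum_nn : ∀ t ∈ Icc (0 : ℝ) 1, 0 ≤ ∑ i, F i t := fun t ht =>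
    Finset.sum_nonneg fun i _ => hFnn i t ht
  refine ⟨?_, ?_⟩
  · rw [← hval]
    exact setIntegral_nonneg measurableSet_Icc hsum_nn
  · have hae : ∀ᵐ t ∂(volume.restrict (Icc (0 : ℝ) 1)), 0 ≤ ∑ i, F i t :=
      (ae_restrict_iff' measurableSet_Icc).mpr (Filter.Eventually.of_forall hsum_nn)
    have hintegral : IntegrableOn (fun t => ∑ i, F i t) (Icc 0 1) :=
      (continuousOn_finsetSum _ fun i _ => hFc i).integrableOn_Icc
    rw [← hval, ofReal_integral_eq_lintegral_ofReal hintegral hae, action]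
    refine setLIntegral_congr_fun measurableSet_Icc fun t ht => ?_
    rw [metricSq_odiag hU hU' (fun i => (hs i).pos t ht) hlam
      (fun x => ((h.density t ht).pos x).le) (hmom t ht) hf, ← ENNReal.ofReal_mul ht.1,
      Finset.mul_sum]

end Geodesics

/-! ### Existence of the dual geodesic -/

section Existence

/-- In terms of z = 1 + λ/c the variance equation reads z' = -2λβz, so log z is interpolated
linearly between its end values l₀ and l₁, and β = (l₀ - l₁)/(2λ). Positive l₀, l₁ keep z > 1, hence
c finite and positive. -/
theorem exists_isScalarGeodesic {lam p q : ℝ} (hlam : 0 < lam) (hp : 0 < p) (hq : 0 < q)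
    (n₀ n₁ : ℝ) :
    ∃ (β b : ℝ) (c n : ℝ → ℝ), IsScalarGeodesic lam β b c n ∧ ContDiffOn ℝ ∞ c (Icc 0 1) ∧
      ContDiffOn ℝ ∞ n (Icc 0 1) ∧ c 0 = p ∧ c 1 = q ∧ n 0 = n₀ ∧ n 1 = n₁ := by
  set l₀ := Real.log (1 + lam / p) with hl₀
  set l₁ := Real.log (1 + lam / q) with hl₁
  have e₀ : Real.exp l₀ = 1 + lam / p := Real.exp_log (by positivity)
  have e₁ : Real.exp l₁ = 1 + lam / q := Real.exp_log (by positivity)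
  have pos₀ : 0 < l₀ := Real.log_pos (by have : 0 < lam / p := by positivity
                                         linarith)
  have pos₁ : 0 < l₁ := Real.log_pos (by have : 0 < lam / q := by positivity
                                         linarith)
  set z : ℝ → ℝ := fun t => Real.exp ((1 - t) * l₀ + t * l₁) with hz
  set β := (l₀ - l₁) / (2 * lam) with hβ
  have hz1 : ∀ t ∈ Icc (0 : ℝ) 1, 0 < z t - 1 := fun t ht => by
    have h1 : 0 < (1 - t) * l₀ + t * l₁ := by
      rcases ht.2.lt_or_eq with h | rfl
      · have : 0 < (1 - t) * l₀ := mul_pos (by linarith) pos₀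
        have : 0 ≤ t * l₁ := mul_nonneg ht.1 pos₁.le
        linarith
      · linarith
    have := Real.one_lt_exp_iff.mpr h1
    simp only [hz]; linarith
  have hzd : ∀ t, HasDerivAt z (-(2 * lam * β) * z t) t := fun t => by
    have h1 : HasDerivAt (fun t : ℝ => (1 - t) * l₀ + t * l₁) (l₁ - l₀) t := by
      refine ((((hasDerivAt_id' t).const_sub 1).mul_const l₀).add
        ((hasDerivAt_id' t).mul_const l₁)).congr_deriv ?_
      ring
    refine h1.exp.congr_deriv ?_
    rw [hβ]; simp only [hz]; field_simp; ring
  have hzs : ContDiff ℝ ∞ z := by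
    simp only [hz]; fun_prop
  set c : ℝ → ℝ := fun t => lam / (z t - 1) with hc
  have hcpos : ∀ t ∈ Icc (0 : ℝ) 1, 0 < c t := fun t ht => div_pos hlam (hz1 t ht)
  have hcd : ∀ t ∈ Icc (0 : ℝ) 1,
      HasDerivWithinAt c (2 * β * (c t + lam) * c t) (Icc 0 1) t := fun t ht => by
    have h0 := (hz1 t ht).ne'
    have h1 := ((hasDerivAt_const t lam).div ((hzd t).sub_const 1) h0).hasDerivWithinAt
      (s := Icc (0 : ℝ) 1)
    refine h1.congr_deriv ?_
    simp only [hc]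
    field_simp
    ring
  have hcs : ContDiffOn ℝ ∞ c (Icc 0 1) :=
    contDiffOn_const.div (hzs.contDiffOn.sub contDiffOn_const) fun t ht => (hz1 t ht).ne'
  have hc0 : c 0 = p := by
    simp only [hc, hz]
    rw [sub_zero, one_mul, zero_mul, add_zero, e₀, add_sub_cancel_left, div_div_cancel₀ hlam.ne']
  have hc1 : c 1 = q := by
    simp only [hc, hz]
    rw [sub_self, zero_mul, zero_add, one_mul, e₁, add_sub_cancel_left, div_div_cancel₀ hlam.ne']
  rcases eq_or_ne l₀ l₁ with hl | hl
  · have hβ0 : β = 0 := by rw [hβ, hl]; simp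
    have hconst : ∀ t ∈ Icc (0 : ℝ) 1, c t = p := fun t ht => by
      rw [← hc0]
      exact eq_of_hasDerivWithinAt_zero (fun s hs => (hcd s hs).congr_deriv (by rw [hβ0]; ring)) ht
    refine ⟨β, (n₁ - n₀) / (p + lam), c, fun t => n₀ + t * (n₁ - n₀), ⟨hcpos, hcd, fun t ht => ?_⟩,
      hcs, by fun_prop, hc0, hc1, by simp, by simp⟩
    refine (((hasDerivAt_id' t).mul_const (n₁ - n₀)).const_add n₀).hasDerivWithinAt.congr_deriv ?_
    rw [hconst t ht, hβ0]
    field_simp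
    ring
  · have hpq : √q - √p ≠ 0 := fun he => by
      have : q = p := (Real.sqrt_inj hq.le hp.le).mp (sub_eq_zero.mp he)
      exact hl (by rw [hl₀, hl₁, this])
    set k := (n₁ - n₀) / (√q - √p) with hk
    -- Since βn + b must be proportional to √c, the mean is affine in √c. The end means fix k, and
    -- this choice of b makes βn + b = kβ√c.
    refine ⟨β, k * β * √p - β * n₀, c, fun t => n₀ + k * (√(c t) - √p), ⟨hcpos, hcd, fun t ht => ?_⟩,
      hcs, ?_, hc0, hc1, by simp [hc0], ?_⟩
    · have hs : √(c t) ≠ 0 := (Real.sqrt_pos.mpr (hcpos t ht)).ne'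
      refine (((((hcd t ht).sqrt (hcpos t ht).ne').sub_const √p).const_mul k).const_add
        n₀).congr_deriv ?_
      calc k * (2 * β * (c t + lam) * c t / (2 * √(c t))) =
            k * β * (c t + lam) * (c t / √(c t)) := by field_simp
        _ = _ := by rw [Real.div_sqrt]; ring
    · exact contDiffOn_const.add (contDiffOn_const.mul
        ((hcs.sqrt fun t ht => (hcpos t ht).ne').sub contDiffOn_const))
    · simp only [hc1, hk]
      field_simp
      ring

theorem hasDerivWithinAt_prod_of_log {ι : Type*} (s : Finset ι) {r : ι → ℝ → ℝ} {k : ι → ℝ}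
    {S : Set ℝ} {t : ℝ} (h : ∀ i, HasDerivWithinAt (r i) (k i * r i t) S t) :
    HasDerivWithinAt (fun t => ∏ i ∈ s, r i t) ((∑ i ∈ s, k i) * ∏ i ∈ s, r i t) S t := by
  classical
  induction s using Finset.induction_on with
  | empty => simpa using hasDerivWithinAt_const t S (1 : ℝ)
  | insert i s hi ih =>
    simp only [Finset.prod_insert hi, Finset.sum_insert hi]
    refine ((h i).mul ih).congr_deriv ?_
    ring

variable {d : ℕ} {U : Matrix (Fin d) (Fin d) ℝ} {g : ℝ → ℝ} {lam : ℝ}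

theorem act_whiten_apply (U : Matrix (Fin d) (Fin d) ℝ) (a : Fin d → ℝ) (x : E d) (i : Fin d) :
    act (whiten U a) x i = (√(a i))⁻¹ * act Uᵀ x i := by
  rw [whiten, act_mul]
  exact Matrix.mulVec_diagonal (fun i => (√(a i))⁻¹) (act Uᵀ x).ofLp i

/-- Scalar dual geodesics in the coordinates of an orthonormal basis combine to a dual geodesic of
elliptic distributions. -/
theorem isDualGeodesic_of_scalar (hU : U * Uᵀ = 1) (hU' : Uᵀ * U = 1) (hg : IsGenerator d g)
    (hlam : 0 < lam) {β : Fin d → ℝ} {b : E d} {c n : Fin d → ℝ → ℝ}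
    (hs : ∀ i, IsScalarGeodesic lam (β i) (act Uᵀ b i) (c i) (n i))
    (hc : ∀ i, ContDiffOn ℝ ∞ (c i) (Icc 0 1)) (hn : ∀ i, ContDiffOn ℝ ∞ (n i) (Icc 0 1)) :
    IsDualGeodesic lam (fun x => 1 / 2 * quadForm (odiag U β) x + inner ℝ b x + 0)
      fun t => ellipticDensity (act U (WithLp.toLp 2 fun i => n i t))
        (odiag U fun i => (kappa d g)⁻¹ * c i t) g := by
  have hκ := hg.kappa_pos
  set κ := kappa d g
  set m : ℝ → E d := fun t => act U (WithLp.toLp 2 fun i => n i t) with hm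
  set σ : ℝ → Fin d → ℝ := fun t i => κ⁻¹ * c i t with hσ
  have hσpos : ∀ t ∈ Icc (0 : ℝ) 1, ∀ i, 0 < σ t i := fun t ht i =>
    mul_pos (inv_pos.mpr hκ) ((hs i).pos t ht)
  set r : Fin d → ℝ → ℝ := fun i t => (√(σ t i))⁻¹ with hr
  have hUm : ∀ t, act Uᵀ (m t) = WithLp.toLp 2 fun i => n i t := fun t => by
    simp only [hm]
    rw [← act_mul, hU', act_one]
  have hcovt : ∀ t ∈ Icc (0 : ℝ) 1, cov (ellipticDensity (m t) (odiag U (σ t)) g) =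
      odiag U fun i => c i t := fun t ht => by
    rw [(hasMoments_ellipticDensity hU hU' (hσpos t ht) hg (m t)).cov_eq]
    congr 1; ext i
    exact mul_inv_cancel_left₀ hκ.ne' _
  -- In whitened coordinates y the density is a Jacobian ∏ r i times a fixed radial profile, so only
  -- r and y depend on time.
  set y : ℝ → E d → E d := fun t x => WithLp.toLp 2 fun i => r i t * (act Uᵀ x i - n i t) with hy
  have hyw : ∀ t x, act (whiten U (σ t)) (x - m t) = y t x := fun t x => by
    ext i
    rw [act_whiten_apply, act_sub, hUm]
    rfl
  have hρ : ∀ t ∈ Icc (0 : ℝ) 1, ∀ x, ellipticDensity (m t) (odiag U (σ t)) g x =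
      (∏ i, r i t) * g (‖y t x‖ ^ 2) := fun t ht x => by
    rw [ellipticDensity_odiag hU hU' (hσpos t ht), hyw]
  set hh : E d → ℝ := fun y => g (‖y‖ ^ 2) with hhdef
  have hhs : ContDiff ℝ ∞ hh := hg.smooth_isotropic
  have hrs : ∀ i, ContDiffOn ℝ ∞ (r i) (Icc 0 1) := fun i =>
    ((contDiffOn_const.mul (hc i)).sqrt fun t ht => (hσpos t ht i).ne').inv
      fun t ht => (Real.sqrt_pos.mpr (hσpos t ht i)).ne'
  have hrd : ∀ i, ∀ t ∈ Icc (0 : ℝ) 1,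
      HasDerivWithinAt (r i) (-((c i t + lam) * β i) * r i t) (Icc 0 1) t := fun i t ht => by
    have hp := hσpos t ht i
    have hsq : √(σ t i) ≠ 0 := (Real.sqrt_pos.mpr hp).ne'
    have h1 := ((((hs i).var t ht).const_mul κ⁻¹).sqrt hp.ne').inv hsq
    refine h1.congr_deriv ?_
    have e : √(κ⁻¹ * c i t) ^ 2 = κ⁻¹ * c i t := Real.sq_sqrt hp.le
    have hc0 := (hs i).pos t ht
    change -(κ⁻¹ * (2 * β i * (c i t + lam) * c i t) / (2 * √(κ⁻¹ * c i t))) / √(κ⁻¹ * c i t) ^ 2 =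
      -((c i t + lam) * β i) * (√(κ⁻¹ * c i t))⁻¹
    rw [e]
    field_simp
  refine ⟨contDiff_quadratic _ _ _, fun t ht =>
    isSmoothPosDensity_ellipticDensity hU hU' (hσpos t ht) hg (m t), ?_, ?_, fun t ht x => ?_⟩
  · have hfst : MapsTo (Prod.fst : ℝ × E d → ℝ) (Icc (0 : ℝ) 1 ×ˢ univ) (Icc 0 1) :=
      fun p hp => hp.1
    have h1 : ContDiffOn ℝ ∞ (fun p : ℝ × E d => (∏ i, r i p.1) * hh (y p.1 p.2))
        (Icc (0 : ℝ) 1 ×ˢ univ) := by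
      refine ContDiffOn.mul (contDiffOn_prod fun i _ => (hrs i).comp contDiffOn_fst hfst) ?_
      refine hhs.comp_contDiffOn (contDiffOn_euclidean.mpr fun i => ?_)
      refine ((hrs i).comp contDiffOn_fst hfst).mul
        (ContDiffOn.sub ?_ ((hn i).comp contDiffOn_fst hfst))
      exact (((EuclideanSpace.proj i : E d →L[ℝ] ℝ).comp (actL Uᵀ)).contDiff.comp
        contDiff_snd).contDiffOn
    exact h1.congr fun p hp => hρ p.1 hp.1 p.2
  · have h1 : ContinuousOn (fun t => odiag U fun i => c i t) (Icc (0 : ℝ) 1) := by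
      have h2 : ContinuousOn (fun t => fun i => c i t) (Icc (0 : ℝ) 1) :=
        continuousOn_pi.mpr fun i => (hc i).continuousOn
      have h3 : Continuous fun v : Fin d → ℝ => odiag U v := by
        unfold odiag
        fun_prop
      exact h3.comp_continuousOn h2
    exact h1.congr hcovt
  · have hW := hasFDerivAt_act_affine (whiten U (σ t)) (-act (whiten U (σ t)) (m t)) x
    have hyfun : (fun z => act (whiten U (σ t)) z + -act (whiten U (σ t)) (m t)) = y t := by
      ext1 z
      rw [← hyw, act_sub, sub_eq_add_neg]
    rw [hyfun] at hW
    have hhd : HasFDerivAt hh (fderiv ℝ hh (y t x)) (y t x) :=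
      (hhs.differentiable (by simp) _).hasFDerivAt
    set J : ℝ := ∏ i, r i t with hJ
    have hρx : HasFDerivAt (ellipticDensity (m t) (odiag U (σ t)) g)
        (J • (fderiv ℝ hh (y t x)).comp (actL (whiten U (σ t)))) x := by
      have h1 := (hhd.comp x hW).const_mul J
      have h2 : ellipticDensity (m t) (odiag U (σ t)) g = fun x => J * (hh ∘ y t) x :=
        funext fun z => hρ t ht z
      rw [h2]
      exact h1
    rw [inertia_quadratic (odiag_transpose β) (fun _ => rfl) hρx.differentiableAt, hρx.fderiv,
      hcovt t ht, hρ t ht x, velMat_odiag hU hU', odiag_trace hU']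
    -- The means cancel in r'(x - n) - r n', leaving -r(c + λ)(βx + b): the whitened point moves
    -- with minus the whitened velocity. Meanwhile the Jacobian decays at the rate tr M, so the two
    -- terms are those of the continuity equation.
    have hyt : HasDerivWithinAt (fun s => y s x)
        (-act (whiten U (σ t)) (act (odiag U fun i => (c i t + lam) * β i) x +
          velVec lam (odiag U fun i => c i t) b)) (Icc 0 1) t := by
      rw [hasDerivWithinAt_iff_hasFDerivWithinAt, hasFDerivWithinAt_euclidean]
      intro i
      rw [hasFDerivWithinAt_iff_hasDerivWithinAt]
      have h1 := (hrd i t ht).mul (((hs i).mean t ht).const_sub (act Uᵀ x i))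
      refine h1.congr_deriv ?_
      simp only [ContinuousLinearMap.comp_apply, ContinuousLinearMap.toSpanSingleton_apply,
        one_smul, PiLp.proj_apply]
      rw [PiLp.neg_apply, act_whiten_apply, act_add, PiLp.add_apply, act_transpose_odiag hU']
      have h2 : act Uᵀ (velVec lam (odiag U fun i => c i t) b) i =
          (c i t + lam) * act Uᵀ b i := by
        have e2 : (odiag U fun i => c i t) + lam • 1 = odiag U fun i => c i t + lam := by
          rw [← odiag_one hU, smul_odiag, odiag_add]; simp
        rw [velVec, e2, act_transpose_odiag hU']
      rw [h2]
      ring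
    have h1 := (hasDerivWithinAt_prod_of_log Finset.univ fun i => hrd i t ht).mul
      (hhd.comp_hasDerivWithinAt t hyt)
    refine (h1.congr (fun s hs => hρ s hs x) (hρ t ht x)).congr_deriv ?_
    simp only [Function.comp_apply, map_neg, smul_apply, ContinuousLinearMap.comp_apply, actL_apply,
      smul_eq_mul, Finset.sum_neg_distrib, ← hJ]
    ring

end Existence

/-! ### The value of the divergence as a sum over coordinates. -/

section Divergence

variable {d : ℕ} {U : Matrix (Fin d) (Fin d) ℝ} {g : ℝ → ℝ} {lam : ℝ}

/-- The infimum runs over a nonempty family on which the action is constant: the product of scalar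
solutions gives one inequality, `IsDualGeodesic.action_eq` for an arbitrary competitor the other. -/
theorem divKW_ellipticDensity (hU : U * Uᵀ = 1) (hU' : Uᵀ * U = 1) (hg : IsGenerator d g)
    (hlam : 0 < lam) {a b : Fin d → ℝ} (ha : ∀ i, 0 < a i) (hb : ∀ i, 0 < b i) (m₀ m₁ : E d) :
    0 ≤ ∑ i, coordValue lam (kappa d g * a i) (kappa d g * b i) (act Uᵀ (m₁ - m₀) i) ∧
      divKW lam (ofDensity (ellipticDensity m₀ (odiag U a) g))
          (ofDensity (ellipticDensity m₁ (odiag U b) g)) =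
        ENNReal.ofReal
          (∑ i, coordValue lam (kappa d g * a i) (kappa d g * b i) (act Uᵀ (m₁ - m₀) i)) := by
  have hκ := hg.kappa_pos
  have hp : ∀ i, 0 < kappa d g * a i := fun i => mul_pos hκ (ha i)
  have hq : ∀ i, 0 < kappa d g * b i := fun i => mul_pos hκ (hb i)
  have hmom : ∀ {ρ : E d → ℝ} {v : Fin d → ℝ} {m : E d}, (∀ i, 0 < v i) → IsSmoothPosDensity ρ →
      ofDensity ρ = ofDensity (ellipticDensity m (odiag U v) g) →
      HasMoments ρ m (odiag U fun i => kappa d g * v i) := fun {ρ v m} hv hρ he =>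
    (hasMoments_ellipticDensity hU hU' hv hg m).congr_ae
      (ae_eq_of_ofDensity_eq hρ (isSmoothPosDensity_ellipticDensity hU hU' hv hg m) he).symm
  choose β b' c n hs hc hn hc0 hc1 hn0 hn1 using fun i =>
    exists_isScalarGeodesic hlam (hp i) (hq i) (act Uᵀ m₀ i) (act Uᵀ m₁ i)
  have hUb : act Uᵀ (act U (WithLp.toLp 2 b')) = WithLp.toLp 2 b' := by
    rw [← act_mul, hU', act_one]
  have hgeo := isDualGeodesic_of_scalar (b := act U (WithLp.toLp 2 b')) hU hU' hg hlam (β := β)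
    (c := c) (n := n) (fun i => by rw [hUb]; exact hs i) hc hn
  set f : E d → ℝ := fun x => 1 / 2 * quadForm (odiag U β) x +
    inner ℝ (act U (WithLp.toLp 2 b')) x + 0
  set ρ : ℝ → E d → ℝ := fun t => ellipticDensity (act U (WithLp.toLp 2 fun i => n i t))
    (odiag U fun i => (kappa d g)⁻¹ * c i t) g with hρ
  have hUm : ∀ m : E d, act U (WithLp.toLp 2 fun i => act Uᵀ m i) = m := fun m => by
    change act U (act Uᵀ m) = m
    rw [← act_mul, hU, act_one]
  have hρ0 : ρ 0 = ellipticDensity m₀ (odiag U a) g := by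
    simp only [hρ, hc0, hn0, hUm, inv_mul_cancel_left₀ hκ.ne']
  have hρ1 : ρ 1 = ellipticDensity m₁ (odiag U b) g := by
    simp only [hρ, hc1, hn1, hUm, inv_mul_cancel_left₀ hκ.ne']
  have hquad : IsQuadratic f := ⟨odiag U β, _, 0, odiag_transpose β, fun _ => rfl⟩
  obtain ⟨hnn, hact⟩ := hgeo.action_eq hU hU' hlam hp hq hquad
    (hmom ha (hgeo.density 0 (by simp)) (by rw [hρ0]))
    (hmom hb (hgeo.density 1 (by simp)) (by rw [hρ1]))
  refine ⟨hnn, le_antisymm ?_ ?_⟩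
  · rw [← hact]
    exact iInf_le_of_le f <| iInf_le_of_le ρ <| iInf_le_of_le hquad <| iInf_le_of_le hgeo <|
      iInf_le_of_le (by rw [hρ0]) <| iInf_le_of_le (by rw [hρ1]) le_rfl
  · refine le_iInf fun f' => le_iInf fun ρ' => le_iInf fun hf' => le_iInf fun hgeo' =>
      le_iInf fun h0 => le_iInf fun h1 => ?_
    exact (hgeo'.action_eq hU hU' hlam hp hq hf' (hmom ha (hgeo'.density 0 (by simp)) h0)
      (hmom hb (hgeo'.density 1 (by simp)) h1)).2.ge

end Divergence

end KW

end

/-- Equality with a real number in `EReal` includes finiteness of the divergence. Nonnegativity of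
the sum is needed because `ENNReal.ofReal` truncates negative values to 0. -/
theorem mainTheorem1 {d : ℕ} (m₀ m₁ : KW.E d) (S₀ S₁ : Matrix (Fin d) (Fin d) ℝ) (g : ℝ → ℝ)
    (μ ν : Measure (KW.E d))
    (hμ : KW.IsElliptic m₀ S₀ g μ) (hν : KW.IsElliptic m₁ S₁ g ν)
    (hdiag : KW.SimDiag S₀ S₁) (lam : ℝ) (hlam : 0 < lam) :
    ((KW.divKW lam μ ν : ℝ≥0∞) : EReal) =
      ((KW.kappa d g / (4 * lam) * (KW.Xi (KW.kappa d g) lam S₀ S₁).trace +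
        1 / 2 * KW.quadForm
          (KW.projPerp S₀ S₁ * (KW.inflate (KW.kappa d g) lam S₀)⁻¹ * KW.projPerp S₀ S₁ +
            (1 / (2 * lam)) • (KW.proj S₀ S₁ * KW.Xi (KW.kappa d g) lam S₀ S₁ * KW.proj S₀ S₁ *
              KW.pinv (KW.msqrt S₁ - KW.msqrt S₀) ^ 2))
          (m₁ - m₀) : ℝ) : EReal) := by
  obtain ⟨U, a, b, hU, hU', rfl, rfl⟩ :=
    hdiag.exists_odiag hμ.posDef.isHermitian hν.posDef.isHermitian
  have ha := KW.odiag_pos_of_posDef hU' hμ.posDef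
  have hb := KW.odiag_pos_of_posDef hU' hν.posDef
  obtain ⟨hnn, hval⟩ := KW.divKW_ellipticDensity hU hU' hμ.generator hlam ha hb m₀ m₁
  rw [hμ.density, hν.density, hval,
    KW.closedForm_eq_sum hU hU' ha hb hμ.generator.kappa_pos hlam, EReal.coe_ennreal_ofReal,
    max_eq_left hnn]
  rfl
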